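/- **Setting.** Let $\mathcal X$ be a measurable space, $n\ge 1$, and let $\mathcal D=(D_1,\dots,D_n)$ be probability distributions on $\mathcal X\times\{0,1\}$. Let $\mathcal H\subseteq\{0,1\}^{\mathcal X}$ be a nonempty class of measurable binary classifiers of finite VC dimension $d$, and let the loss be $\ell(h,(x,y))=g(h(x),y)$ for some $g:\{0,1\}^2\to[0,1]$. Write $\mathcal R_D(h)=\mathbb E_{z\sim D}[\ell(h,z)]$, and $\mathcal R_D(Q)=\mathbb E_{f\sim Q}[\mathcal R_D(f)]$ for a (discrete) probability distribution $Q\in\Delta(\mathcal H)$ supported on $\mathcal H$. For $\epsilon>0$, call $Q$ an $\epsilon$-optimal randomized solution to $(\mathcal H,\mathcal D)$ if $$\max_{i\le n}\mathcal R_{D_i}(Q)\le \mathrm{OPT}+\epsilon,\qquad \mathrm{OPT}=\inf_{h\in\mathcal H}\max_{i\le n}\mathcal R_{D_i}(h).$$ An algorithm has access to the distributions $D_i$ only through example oracles: each call to the $i$-th oracle returns a fresh independent draw from $D_i$. It may choose the oracles to call adaptively and at random. Its sample complexity is its total number of oracle calls. It may depend on $\mathcal X,\mathcal H,\ell,n,d,\epsilon,\delta$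 and on the side information named below, but not on $\mathcal D$ otherwise. **Theorem.** Let $\epsilon,\delta\in(0,1)$ and consider the following assumptions. 1. $\epsilon\le c/n$ for a constant $c>0$. (Here $\mathcal H$ is also assumed to be pointwise measurable: it has a countable subclass $\mathcal H_0$ such that every $h\in\mathcal H$ is the pointwise limit of a sequence in $\mathcal H_0$.) 2. The algorithm knows the marginal distribution of each $D_i$ on $\mathcal X$. 3. The algorithm knows probability distributions $P_1,\dots,P_n$ on $\mathcal X$ such that, for every $i$ and every measurable $A\subseteq\mathcal X$, the marginal of $D_i$ gives $A$ mass at most $p(1/\epsilon,d,n)\,P_i(A)$, where $p$ is a fixed real polynomial in three variables. Under any one of these assumptions, there is an algorithm that, for all $\mathcal D$ satisfying the assumption, returns with probability at least $1-\delta$ an $\epsilon$-optimal randomized solution $Q\in\Delta(\mathcal H)$ to $(\mathcal H,\mathcal D)$, and whose sample complexity is at most $$C\cdot\max\Bigl\{1,\ \epsilon^{-2}\bigl(d\log(dn/\epsilon)+n\log(n/\delta)\bigr)\Bigr\}\qquad(0\log 0=0),$$ that is, $O\bigl(\epsilon^{-2}(d\log(dn/\epsilon)+n\log(n/\delta))\bigr)$.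 The constant $C$ depends only on $c$ under Assumption 1, is absolute under Assumption 2, and depends only on $p$ under Assumption 3. -/

import Mathlib

open MeasureTheory ProbabilityTheory
open scoped ENNReal

namespace CollabLearning

/-! ### VC dimension -/

/-- `H` shatters the finite set `S`: every labelling of `S` is realised by a classifier of `H`. -/
def Shatters {X : Type*} (H : Set (X → Bool)) (S : Finset X) : Prop :=
  ∀ b : X → Bool, ∃ h ∈ H, ∀ x ∈ S, h x = b x

/-- The VC dimension: the supremum of the sizes of the shattered finite sets. -/
noncomputable def vcDim {X : Type*} (H : Set (X → Bool)) : ℕ∞ :=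
  ⨆ S : {S : Finset X // Shatters H S}, (S.1.card : ℕ∞)

/-- A pointwise measurable class: some countable subclass has every member of the class as the
pointwise limit of one of its sequences (for labels in a discrete space, pointwise convergence
means that the labels of each point are eventually constant). -/
def PointwiseMeasurable {X : Type*} (H : Set (X → Bool)) : Prop :=
  ∃ H₀ ⊆ H, H₀.Countable ∧ ∀ h ∈ H, ∃ u : ℕ → X → Bool,
    (∀ k, u k ∈ H₀) ∧ ∀ x, ∀ᶠ k in Filter.atTop, u k x = h x

/-! ### Risks and optimality -/

section Risk

variable {X : Type*} [MeasurableSpace X]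

/-- The risk `E_{(x, y) ∼ D} [g (h x) y]` of a classifier. -/
noncomputable def risk (g : Bool → Bool → ℝ) (D : ProbabilityMeasure (X × Bool))
    (h : X → Bool) : ℝ :=
  ∫ z, g (h z.1) z.2 ∂(D : Measure (X × Bool))

/-- The risk `E_{f ∼ Q} [risk f]` of a randomized classifier with (discrete) law `Q`. -/
noncomputable def randRisk (g : Bool → Bool → ℝ) (D : ProbabilityMeasure (X × Bool))
    (Q : PMF (X → Bool)) : ℝ :=
  ∑' f, (Q f).toReal * risk g D f

/-- The benchmark: the best worst-case risk of a classifier of `H`. -/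
noncomputable def opt {n : ℕ} (H : Set (X → Bool)) (g : Bool → Bool → ℝ)
    (D : Fin n → ProbabilityMeasure (X × Bool)) : ℝ :=
  ⨅ h : H, ⨆ i, risk g (D i) h.1

/-- `Q` is an `ε`-optimal randomized solution: its worst-case risk is at most `opt + ε`. -/
def IsEpsOptimal {n : ℕ} (H : Set (X → Bool)) (g : Bool → Bool → ℝ)
    (D : Fin n → ProbabilityMeasure (X × Bool)) (ε : ℝ) (Q : PMF (X → Bool)) : Prop :=
  Q.support ⊆ H ∧ ⨆ i, randRisk g (D i) Q ≤ opt H g D + ε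

end Risk

/-! ### Sampling algorithms -/

/-- A transcript of `t` oracle calls: which oracle was called, and the example it returned. -/
abbrev Transcript (X : Type*) (n t : ℕ) : Type _ := Fin t → Fin n × (X × Bool)

/-- A randomized, adaptive algorithm that makes `m` calls to the example oracles `0, …, n - 1`.
Call number `t` goes to an oracle drawn from a law that depends on the transcript so far; the
output is a randomized classifier supported on `H`, depending measurably on the transcript, in
the sense that the probability with which it labels `x` by `true` is a jointly measurable function
of the transcript and `x`. The data distributions are not an input: they are met only through
the oracle calls. -/
structure Algorithm {X : Type*} [MeasurableSpace X] (H : Set (X → Bool)) (n m : ℕ) where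
  query : (t : ℕ) → Kernel (Transcript X n t) (Fin n)
  isMarkov : ∀ t, IsMarkovKernel (query t)
  output : Transcript X n m → PMF (X → Bool)
  output_support : ∀ τ, (output τ).support ⊆ H
  measurable_output : Measurable fun p : Transcript X n m × X =>
    ((output p.1).map fun f => f p.2) true

section Law

variable {X : Type*} [MeasurableSpace X] {n : ℕ}

/-- The example oracles as a kernel: calling oracle `i` returns a draw from `D i`. -/
noncomputable def oracle (D : Fin n → ProbabilityMeasure (X × Bool)) :
    Kernel (Fin n) (X × Bool) where
  toFun i := (D i : Measure (X × Bool))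
  measurable' := measurable_of_finite _

instance (D : Fin n → ProbabilityMeasure (X × Bool)) : IsMarkovKernel (oracle D) :=
  ⟨fun i => (D i).2⟩

theorem measurable_snoc (t : ℕ) : Measurable fun p : Transcript X n t × (Fin n × (X × Bool)) =>
    (Fin.snoc p.1 p.2 : Transcript X n (t + 1)) := by
  refine measurable_pi_lambda _ fun i => ?_
  refine Fin.lastCases ?_ (fun j => ?_) i
  · simpa using measurable_snd
  · simp only [Fin.snoc_castSucc]
    exact (measurable_pi_apply j).comp measurable_fst

/-- The law of the transcript of the first `t` calls when oracle `i` samples from `D i`: given the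
past transcript, an index `i` is drawn from the query law and then a fresh example from `D i`. -/
noncomputable def Algorithm.law {H : Set (X → Bool)} {m : ℕ} (A : Algorithm H n m)
    (D : Fin n → ProbabilityMeasure (X × Bool)) : (t : ℕ) → Measure (Transcript X n t)
  | 0 => Measure.dirac Fin.elim0
  | t + 1 => (A.law D t ⊗ₘ (A.query t ⊗ₖ Kernel.prodMkLeft (Transcript X n t) (oracle D))).map
      fun p => Fin.snoc p.1 p.2

instance {H : Set (X → Bool)} {m : ℕ} (A : Algorithm H n m)
    (D : Fin n → ProbabilityMeasure (X × Bool)) (t : ℕ) :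
    IsProbabilityMeasure (A.law D t) := by
  induction t with
  | zero => unfold Algorithm.law; infer_instance
  | succ t ih =>
    have := A.isMarkov t
    unfold Algorithm.law
    exact Measure.isProbabilityMeasure_map (measurable_snoc t).aemeasurable

/-- Some algorithm making at most `N` oracle calls returns, for every tuple of data distributions
in `𝔇`, an `ε`-optimal randomized solution with probability at least `1 - δ`. The algorithm is
chosen before the tuple, so `𝔇` expresses what it knows beforehand about the distributions. -/
def SolvableWithin (H : Set (X → Bool)) (g : Bool → Bool → ℝ) (ε δ N : ℝ)
    (𝔇 : Set (Fin n → ProbabilityMeasure (X × Bool))) : Prop :=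
  ∃ m : ℕ, (m : ℝ) ≤ N ∧ ∃ A : Algorithm H n m, ∀ D ∈ 𝔇,
    ENNReal.ofReal (1 - δ) ≤ A.law D m {τ | IsEpsOptimal H g D ε (A.output τ)}

end Law

/-! ### The problem, and the information available on the marginals -/

/-- Standing conditions: `n ≥ 1` distributions, a nonempty class of measurable binary classifiers
of VC dimension `d`, a loss `ℓ (h, (x, y)) = g (h x) y` with values in `[0, 1]`, and accuracy and
confidence parameters in `(0, 1)`. -/
structure IsProblem {X : Type*} [MeasurableSpace X] (H : Set (X → Bool)) (d n : ℕ)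
    (g : Bool → Bool → ℝ) (ε δ : ℝ) : Prop where
  n_pos : 0 < n
  nonempty : H.Nonempty
  measurable : ∀ h ∈ H, Measurable h
  vcDim_eq : vcDim H = d
  loss_mem : ∀ a b, g a b ∈ Set.Icc (0 : ℝ) 1
  eps_mem : ε ∈ Set.Ioo (0 : ℝ) 1
  delta_mem : δ ∈ Set.Ioo (0 : ℝ) 1

/-- The tuples of data distributions whose feature marginals are `μ 0, …, μ (n - 1)`. -/
def withMarginals {X : Type*} [MeasurableSpace X] {n : ℕ} (μ : Fin n → ProbabilityMeasure X) :
    Set (Fin n → ProbabilityMeasure (X × Bool)) :=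
  {D | ∀ i, (D i : Measure (X × Bool)).map Prod.fst = (μ i : Measure X)}

/-- The tuples of data distributions whose feature marginals are dominated by `K • P i`. -/
def dominatedBy {X : Type*} [MeasurableSpace X] {n : ℕ} (K : ℝ) (P : Fin n → ProbabilityMeasure X) :
    Set (Fin n → ProbabilityMeasure (X × Bool)) :=
  {D | ∀ i, ∀ A : Set X, MeasurableSet A →
    (D i : Measure (X × Bool)).map Prod.fst A ≤ ENNReal.ofReal K * (P i : Measure X) A}

/-- The rate `ε⁻² (d log (d n / ε) + n log (n / δ))`, with `0 log 0 = 0`; the maximum with `1`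
only matters when it is below `1`. -/
noncomputable def rate (d n : ℕ) (ε δ : ℝ) : ℝ :=
  max 1 ((d * Real.log (d * n / ε) + n * Real.log (n / δ)) / ε ^ 2)

end CollabLearning

/-! Learning here is a zero-sum game: the learner picks a hypothesis, the adversary one of the n
distributions, and the payoff is the risk. Suppose finitely many hypotheses are at hand, one of them
with all risks at most `opt + ε/4`. Both players run exponential weights. Each round costs one
example, drawn from the adversary's strategy mixed half and half with the uniform law, and this one
example feeds both updates through importance weights. The learner's weights are at most 2 while the
adversary's can reach 2n, so the learning rates are of order ε and ε/n. The first-order terms of the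
two log-partition functions cancel draw by draw (`Scheme.potential_step_le`), hence the regret bound
`Scheme.gain_sub_loss_le` is deterministic. Exponential supermartingales and Markov's inequality
relate estimates to true risks (`Scheme.law_cumRisk_sub_gain_le`, `Scheme.law_loss_le`), and
`Scheme.guarantee` combines the three. About ε⁻²(n log(n/δ) + n + L) rounds suffice, where L bounds
the logarithm of the total prior mass.

What remains is a small set of hypotheses. With known dominating marginals, a maximal separated
subset of H under the uniform mixture of the P i is a finite cover, and Sauer–Shelah bounds its
log-size by O(d log(d/θ)) at scale θ (`exists_cover_log_card_le`). Passing from the mixture to a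
single D i costs a factor polynomial in 1/ε, d, n, which only enters a logarithm. No calls are spent
on this step, and known marginals are the case p = 1.

When ε ≤ c/n, the cover is learnt instead. About (n/ε)(d log(dn/ε) + log(1/δ)) calls to uniformly
random oracles give a sample, and one hypothesis is kept per realised labelling of it. By double
sampling (`measure_missing_mul_le`), every enumerated hypothesis that agrees with a near-optimal
classifier on the sample is probably close to it under the pooled law, hence under every D i at the
cost of a factor n. The factor n/ε is at most c/ε², so these calls fit the budget. Pointwise
measurability supplies the enumeration that makes the selection measurable. -/

namespace CollabLearning

/-! ### The growth function -/

section Growth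

variable {X : Type*}

/-- The labellings of a family of points that a class realises. -/
def patterns {ι : Type*} (H : Set (X → Bool)) (x : ι → X) : Set (ι → Bool) :=
  {b | ∃ h ∈ H, ∀ j, h (x j) = b j}

theorem Shatters.card_le {H : Set (X → Bool)} {d : ℕ} (hd : vcDim H = d) {S : Finset X}
    (hS : Shatters H S) : S.card ≤ d := by
  have h : (S.card : ℕ∞) ≤ vcDim H :=
    le_iSup (fun S : {S : Finset X // Shatters H S} => (S.1.card : ℕ∞)) ⟨S, hS⟩
  rw [hd] at h
  exact_mod_cast h

/-- Termwise comparison with the binomial expansion of the right-hand side, using `M.choose k ≤ M ^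
k`. -/
theorem sum_choose_le_pow (M d : ℕ) : ∑ k ∈ Finset.Iic d, M.choose k ≤ (M + 1) ^ d := by
  rw [add_pow, Nat.range_succ_eq_Iic]
  refine Finset.sum_le_sum fun k hk => ?_
  have hk' : k ≤ d := by simpa using hk
  calc M.choose k ≤ M ^ k := Nat.choose_le_pow M k
    _ ≤ M ^ k * 1 ^ (d - k) * d.choose k := by
        rw [one_pow, mul_one]
        exact Nat.le_mul_of_pos_right _ (Nat.choose_pos hk')

/-- Sauer–Shelah for the family of index sets labelled `true`. A shattered set of indices maps to a
shattered set of points of the same size. -/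
theorem ncard_patterns_le {ι : Type*} [Fintype ι] {H : Set (X → Bool)} {d : ℕ}
    (hd : vcDim H = d) (x : ι → X) : (patterns H x).ncard ≤ (Fintype.card ι + 1) ^ d := by
  classical
  let e : (ι → Bool) → Finset ι := fun b => Finset.univ.filter fun j => b j = true
  have he : Function.Injective e := by
    intro b b' h
    funext j
    have hj : j ∈ e b ↔ j ∈ e b' := by rw [h]
    rw [Bool.eq_iff_iff]
    simpa only [e, Finset.mem_filter, Finset.mem_univ, true_and] using hj
  let 𝒜 : Finset (Finset ι) := (patterns H x).toFinset.image e
  have hcard : (patterns H x).ncard = 𝒜.card := by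
    rw [Finset.card_image_of_injective _ he, Set.ncard_eq_toFinset_card']
  have hvc : 𝒜.vcDim ≤ d := by
    refine Finset.sup_le fun s hs => ?_
    rw [Finset.mem_shatterer] at hs
    have key : ∀ t ⊆ s, ∃ h ∈ H, ∀ j ∈ s, h (x j) = true ↔ j ∈ t := by
      intro t ht
      obtain ⟨u, hu, hsu⟩ := hs ht
      simp only [𝒜, Finset.mem_image, Set.mem_toFinset] at hu
      obtain ⟨b, ⟨h, hH, hb⟩, rfl⟩ := hu
      refine ⟨h, hH, fun j hj => ?_⟩
      rw [← hsu, hb]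
      simp [e, hj]
    -- Points may repeat, but a shattered index set cannot contain two indices of one point: they
    -- always get the same label.
    have hinj : Set.InjOn x s := by
      intro i hi j hj hij
      obtain ⟨h, -, hh⟩ := key {i} (by simpa using hi)
      have h1 := (hh i hi).2 (by simp)
      rw [hij] at h1
      exact (Finset.mem_singleton.1 ((hh j hj).1 h1)).symm
    rw [← Finset.card_image_of_injOn hinj]
    refine Shatters.card_le hd fun b => ?_
    obtain ⟨h, hH, hh⟩ := key (s.filter fun j => b (x j) = true) (Finset.filter_subset _ _)
    refine ⟨h, hH, fun y hy => ?_⟩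
    obtain ⟨j, hj, rfl⟩ := Finset.mem_image.1 hy
    rw [Bool.eq_iff_iff, hh j hj]
    simp [hj]
  calc (patterns H x).ncard = 𝒜.card := hcard
    _ ≤ 𝒜.shatterer.card := Finset.card_le_card_shatterer 𝒜
    _ ≤ ∑ k ∈ Finset.Iic 𝒜.vcDim, (Fintype.card ι).choose k :=
        Finset.card_shatterer_le_sum_vcDim
    _ ≤ (Fintype.card ι + 1) ^ 𝒜.vcDim := sum_choose_le_pow _ _
    _ ≤ (Fintype.card ι + 1) ^ d := Nat.pow_le_pow_right (by omega) hvc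

end Growth

/-! ### The double-sampling bound -/

section DoubleSampling

theorem lintegral_pi_prod {ι Y : Type*} [Fintype ι] [MeasurableSpace Y] (ν : Measure Y)
    [IsProbabilityMeasure ν] (f : Y → ℝ≥0∞) (hf : Measurable f) :
    ∫⁻ y, ∏ j, f (y j) ∂(Measure.pi fun _ : ι => ν) = (∫⁻ y, f y ∂ν) ^ Fintype.card ι := by
  have hind : iIndepFun (fun (j : ι) (y : ι → Y) => f (y j)) (Measure.pi fun _ : ι => ν) :=
    iIndepFun_pi (X := fun _ : ι => f) (fun _ => hf.aemeasurable)
  rw [lintegral_prod_eq_prod_lintegral_of_indepFun Finset.univ _ hind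
    (fun j => hf.comp (measurable_pi_apply j))]
  have h : ∀ j : ι, ∫⁻ y, f (y j) ∂(Measure.pi fun _ : ι => ν) = ∫⁻ y, f y ∂ν := fun j =>
    (measurePreserving_eval (fun _ : ι => ν) j).lintegral_comp hf
  simp [h]

/-- The weight of a pair of membership bits: it vanishes when the first point is a hit, and
doubles when the second one is. -/
noncomputable def pairWeight (p q : Bool) : ℝ≥0∞ := (if p then 0 else 1) * (if q then 2 else 1)

/-- Averaged over a swap of the two points, the weight is at most 1, so it behaves like a
supermartingale factor under symmetrisation. -/
theorem pairWeight_add_le (p q : Bool) : pairWeight p q + pairWeight q p ≤ 2 := by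
  cases p <;> cases q <;> simp [pairWeight, one_add_one_eq_two]

-- The product depends on `k` only through a trace on the double sample, so the supremum is at most
-- the sum over the at most `N` traces. For a fixed trace, the sum over all swaps factorises over
-- the coordinates, with factors at most 2.
open Classical in
theorem sum_iSup_pairWeight_le {Y ι : Type*} {m N : ℕ} (A : ι → Set Y)
    (x : Fin m × Bool → Y)
    (hN : (Set.range fun (k : ι) (p : Fin m × Bool) => decide (x p ∈ A k)).ncard ≤ N) :
    ∑ σ : Fin m → Bool, ⨆ k, ∏ j, pairWeight (decide (x (j, σ j) ∈ A k))
      (decide (x (j, !σ j) ∈ A k)) ≤ N * 2 ^ m := by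
  set R := (Set.range fun (k : ι) (p : Fin m × Bool) => decide (x p ∈ A k)).toFinset with hR
  have hcard : (R.card : ℝ≥0∞) ≤ N := by
    rw [Set.ncard_eq_toFinset_card'] at hN
    exact_mod_cast hN
  calc ∑ σ : Fin m → Bool, ⨆ k, ∏ j, pairWeight (decide (x (j, σ j) ∈ A k))
        (decide (x (j, !σ j) ∈ A k))
      ≤ ∑ σ : Fin m → Bool, ∑ b ∈ R, ∏ j, pairWeight (b (j, σ j)) (b (j, !σ j)) := by
        refine Finset.sum_le_sum fun σ _ => iSup_le fun k => ?_
        exact Finset.single_le_sum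
          (f := fun b : Fin m × Bool → Bool => ∏ j, pairWeight (b (j, σ j)) (b (j, !σ j)))
          (fun _ _ => zero_le) (a := fun p => decide (x p ∈ A k)) (by simp [hR])
    _ = ∑ b ∈ R, ∏ j, ∑ s : Bool, pairWeight (b (j, s)) (b (j, !s)) := by
        rw [Finset.sum_comm]
        refine Finset.sum_congr rfl fun b _ => ?_
        rw [Finset.prod_univ_sum, Fintype.piFinset_univ]
    _ ≤ ∑ b ∈ R, 2 ^ m := by
        refine Finset.sum_le_sum fun b _ => ?_
        refine (Finset.prod_le_pow_card _ _ 2 fun j _ => ?_).trans (by simp)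
        simpa [add_comm] using pairWeight_add_le (b (j, false)) (b (j, true))
    _ ≤ N * 2 ^ m := by
        rw [Finset.sum_const, nsmul_eq_mul]
        gcongr

open Classical in
/-- If the sets `A k` have mass at least `θ` and few traces on double samples, then a sample is
unlikely to miss one of them. -/
theorem measure_missing_mul_le {Y ι : Type*} [MeasurableSpace Y] [Countable ι]
    (ν : Measure Y) [IsProbabilityMeasure ν] (A : ι → Set Y)
    (hA : ∀ k, MeasurableSet (A k)) (θ : ℝ≥0∞) (hθ : ∀ k, θ ≤ ν (A k)) (m N : ℕ)
    (hN : ∀ x : Fin m × Bool → Y,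
      (Set.range fun (k : ι) (p : Fin m × Bool) => decide (x p ∈ A k)).ncard ≤ N) :
    (1 + θ) ^ m * Measure.pi (fun _ : Fin m => ν) {y | ∃ k, ∀ j, y j ∉ A k} ≤ N := by
  set ρ := Measure.pi fun _ : Fin m => ν.prod ν with hρ
  let Φ : ι → (Fin m → Y × Y) → ℝ≥0∞ := fun k z =>
    ∏ j, pairWeight (decide ((z j).1 ∈ A k)) (decide ((z j).2 ∈ A k))
  have hbit : ∀ k, Measurable fun y : Y => decide (y ∈ A k) := fun k =>
    (measurable_of_countable (fun p : Prop => decide p)).comp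
      (measurableSet_setOfPred.1 (hA k))
  have hpw : Measurable fun p : Bool × Bool => pairWeight p.1 p.2 := measurable_of_countable _
  have hΦ : ∀ k, Measurable (Φ k) := fun k => Finset.measurable_prod _ fun j _ =>
    hpw.comp (((hbit k).comp (measurable_fst.comp (measurable_pi_apply j))).prodMk
      ((hbit k).comp (measurable_snd.comp (measurable_pi_apply j))))
  let G : (Fin m → Y × Y) → ℝ≥0∞ := fun z => ⨆ k, Φ k z
  have hG : Measurable G := Measurable.iSup hΦ
  have hbad : MeasurableSet {y : Fin m → Y | ∃ k, ∀ j, y j ∉ A k} := by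
    have h : {y : Fin m → Y | ∃ k, ∀ j, y j ∉ A k} =
        ⋃ k, ⋂ j, (fun y : Fin m → Y => y j) ⁻¹' (A k)ᶜ := by
      ext y
      simp
    rw [h]
    exact MeasurableSet.iUnion fun k => MeasurableSet.iInter fun j =>
      measurable_pi_apply j (hA k).compl
  -- If the first half misses `A k`, its weight is the product of `2` to the hits of the independent
  -- second half, and each factor has mean `1 + ν (A k)`.
  have lower : (1 + θ) ^ m * Measure.pi (fun _ : Fin m => ν) {y | ∃ k, ∀ j, y j ∉ A k}
      ≤ ∫⁻ z, G z ∂ρ := by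
    have e := (measurePreserving_arrowProdEquivProdArrow Y Y (Fin m)
      (fun _ => ν) (fun _ => ν)).symm
    rw [hρ, ← e.lintegral_comp hG, lintegral_prod _ (by exact (hG.comp e.measurable).aemeasurable)]
    rw [← lintegral_indicator_const hbad]
    refine lintegral_mono fun y => ?_
    by_cases hy : y ∈ {y : Fin m → Y | ∃ k, ∀ j, y j ∉ A k}
    · obtain ⟨k, hk⟩ := hy
      rw [Set.indicator_of_mem (show y ∈ {y : Fin m → Y | ∃ k, ∀ j, y j ∉ A k} from ⟨k, hk⟩)]
      calc (1 + θ) ^ m ≤ (∫⁻ y', (if decide (y' ∈ A k) then 2 else 1) ∂ν) ^ m := by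
            gcongr
            have : ∀ y', (if decide (y' ∈ A k) then (2 : ℝ≥0∞) else 1)
                = 1 + (A k).indicator 1 y' := by
              intro y'
              by_cases h : y' ∈ A k <;> simp [h, one_add_one_eq_two]
            simp_rw [this]
            rw [lintegral_add_left measurable_const, lintegral_indicator_one (hA k)]
            simpa using add_le_add_right (hθ k) 1
        _ = ∫⁻ y', ∏ j, (if decide (y' j ∈ A k) then 2 else 1) ∂Measure.pi fun _ : Fin m => ν := by
            rw [lintegral_pi_prod ν (fun y' => if decide (y' ∈ A k) then 2 else 1)
              ((measurable_of_countable fun b : Bool => if b then (2 : ℝ≥0∞) else 1).comp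
                (hbit k)), Fintype.card_fin]
        _ ≤ _ := by
            refine lintegral_mono fun y' => ?_
            refine le_trans (le_of_eq ?_) (le_iSup _ k)
            refine Finset.prod_congr rfl fun j _ => ?_
            by_cases h : y' j ∈ A k <;> simp [h,
              MeasurableEquiv.arrowProdEquivProdArrow, Equiv.arrowProdEquivProdArrow,
              pairWeight, hk j]
    · rw [Set.indicator_of_notMem hy]
      exact zero_le
  -- Swapping coordinates preserves the law of the double sample, so the integral may be averaged
  -- over all `2 ^ m` swaps before the pointwise bound is applied.
  have upper : 2 ^ m * ∫⁻ z, G z ∂ρ ≤ 2 ^ m * N := by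
    let x : (Fin m → Y × Y) → Fin m × Bool → Y := fun z p => if p.2 then (z p.1).2 else (z p.1).1
    have hinv : ∀ σ : Fin m → Bool, ∫⁻ z, G z ∂ρ =
        ∫⁻ z, G (fun j => (x z (j, σ j), x z (j, !σ j))) ∂ρ := by
      intro σ
      have hT : MeasurePreserving (fun (z : Fin m → Y × Y) j =>
          (fun w : Y × Y => if σ j then w.swap else w) (z j)) ρ ρ :=
        measurePreserving_pi _ _ (f := fun j (w : Y × Y) => if σ j then w.swap else w) fun j => by
          cases σ j
          · exact MeasurePreserving.id (ν.prod ν)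
          · exact Measure.measurePreserving_swap (μ := ν) (ν := ν)
      rw [← hT.lintegral_comp hG]
      refine lintegral_congr fun z => congrArg G (funext fun j => ?_)
      cases σ j <;> simp [x, Prod.swap]
    have hmeas : ∀ σ : Fin m → Bool,
        Measurable fun z => G (fun j => (x z (j, σ j), x z (j, !σ j))) := by
      intro σ
      refine hG.comp (measurable_pi_lambda _ fun j => Measurable.prodMk ?_ ?_)
      · cases σ j
        · exact measurable_fst.comp (measurable_pi_apply j)
        · exact measurable_snd.comp (measurable_pi_apply j)
      · cases σ j
        · exact measurable_snd.comp (measurable_pi_apply j)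
        · exact measurable_fst.comp (measurable_pi_apply j)
    calc 2 ^ m * ∫⁻ z, G z ∂ρ = ∑ σ : Fin m → Bool, ∫⁻ z, G z ∂ρ := by simp
      _ = ∫⁻ z, ∑ σ : Fin m → Bool, G (fun j => (x z (j, σ j), x z (j, !σ j))) ∂ρ := by
          rw [lintegral_finsetSum _ fun σ _ => hmeas σ]
          exact Finset.sum_congr rfl fun σ _ => hinv σ
      _ ≤ ∫⁻ z, N * 2 ^ m ∂ρ := lintegral_mono fun z => sum_iSup_pairWeight_le A (x z) (hN (x z))
      _ = 2 ^ m * N := by simp [hρ, mul_comm]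
  exact lower.trans ((ENNReal.mul_le_mul_iff_right (by simp) (by simp)).1 upper)

end DoubleSampling

/-! ### Finite covers -/

section Cover

variable {X : Type*} [MeasurableSpace X]

/-- A finite subset of a class that is separated at scale `θ` has at most `(m + 1) ^ d` elements
as soon as `m` points are likely to separate it. -/
theorem card_le_of_separated {H : Set (X → Bool)} {d : ℕ} (hd : vcDim H = d)
    (hm : ∀ h ∈ H, Measurable h) (P : Measure X) [IsProbabilityMeasure P] {θ : ℝ}
    (F : Finset (X → Bool)) (hF : ↑F ⊆ H)
    (hsep : ∀ h ∈ F, ∀ h' ∈ F, h ≠ h' → θ < P.real {x | h x ≠ h' x}) (m : ℕ)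
    (hFm : (F.card : ℝ) ^ 2 * (1 - θ) ^ m < 1) : F.card ≤ (m + 1) ^ d := by
  classical
  set π := Measure.pi fun _ : Fin m => P
  let B : (X → Bool) × (X → Bool) → Set (Fin m → X) := fun q => {x | ∀ j, q.1 (x j) = q.2 (x j)}
  have hB : ∀ q ∈ F.offDiag, π.real (B q) ≤ (1 - θ) ^ m := by
    intro q hq
    rw [Finset.mem_offDiag] at hq
    have hmeas : MeasurableSet {x | q.1 x ≠ q.2 x} :=
      (measurableSet_eq_fun (hm _ (hF hq.1)) (hm _ (hF hq.2.1))).compl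
    have hset : B q = Set.pi Set.univ fun _ => {x | q.1 x ≠ q.2 x}ᶜ := by
      ext x
      simp [B, Set.mem_pi]
    rw [hset, measureReal_def, Measure.pi_pi, Finset.prod_const, ENNReal.toReal_pow,
      ← measureReal_def, probReal_compl_eq_one_sub hmeas, Finset.card_univ, Fintype.card_fin]
    have h1 : P.real {x | q.1 x ≠ q.2 x} ≤ 1 := measureReal_le_one
    exact pow_le_pow_left₀ (by linarith) (by linarith [hsep _ hq.1 _ hq.2.1 hq.2.2]) m
  -- Union bound over pairs: some sample of `m` points tells all elements of `F` apart, so `F`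
  -- injects into the patterns on it.
  have hunion : π.real (⋃ q ∈ F.offDiag, B q) < 1 := by
    refine (measureReal_biUnion_finset_le _ _).trans_lt ?_
    refine (Finset.sum_le_sum hB).trans_lt ?_
    rw [Finset.sum_const, nsmul_eq_mul]
    by_cases h0 : F.offDiag.card = 0
    · simp [h0]
    · obtain ⟨q, hq⟩ := Finset.card_pos.1 (Nat.pos_of_ne_zero h0)
      -- `θ` is not assumed to be at most 1, so the sign is read off from an actual pair of `F`.
      have hpos : (0 : ℝ) ≤ (1 - θ) ^ m := measureReal_nonneg.trans (hB q hq)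
      refine lt_of_le_of_lt (mul_le_mul_of_nonneg_right ?_ hpos) hFm
      have : F.offDiag.card ≤ F.card ^ 2 := by
        rw [Finset.offDiag_card, sq]; exact Nat.sub_le _ _
      exact_mod_cast this
  obtain ⟨x, hx⟩ : ∃ x, x ∉ ⋃ q ∈ F.offDiag, B q := by
    by_contra! hall
    rw [Set.eq_univ_of_forall hall, probReal_univ] at hunion
    exact lt_irrefl _ hunion
  simp only [Set.mem_iUnion, not_exists] at hx
  calc F.card ≤ (patterns H x).ncard := by
        rw [← Set.ncard_coe_finset]
        refine Set.ncard_le_ncard_of_injOn (fun h j => h (x j))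
          (fun h hh => ⟨h, hF hh, fun _ => rfl⟩) ?_ (Set.toFinite _)
        intro h hh h' hh' heq
        by_contra hne
        exact hx (h, h') (Finset.mem_offDiag.2 ⟨hh, hh', hne⟩) fun j => congrFun heq j
    _ ≤ (m + 1) ^ d := by simpa using ncard_patterns_le hd x

/-- If separated sets have at most `N` elements, then there is a cover of at most `N` elements. -/
theorem exists_cover {H : Set (X → Bool)} (P : Measure X) [IsProbabilityMeasure P] {θ : ℝ} {N : ℕ}
    (hθ : 0 ≤ θ)
    (hN : ∀ F : Finset (X → Bool), ↑F ⊆ H →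
      (∀ h ∈ F, ∀ h' ∈ F, h ≠ h' → θ < P.real {x | h x ≠ h' x}) → F.card ≤ N) :
    ∃ F : Finset (X → Bool), ↑F ⊆ H ∧ F.card ≤ N ∧
      ∀ h ∈ H, ∃ h' ∈ F, P.real {x | h x ≠ h' x} ≤ θ := by
  classical
  let p : ℕ → Prop := fun k => ∃ F : Finset (X → Bool), ↑F ⊆ H ∧
    (∀ h ∈ F, ∀ h' ∈ F, h ≠ h' → θ < P.real {x | h x ≠ h' x}) ∧ F.card = k
  have h0 : p 0 := ⟨∅, by simp, by simp, rfl⟩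
  -- A separated set of maximal size is a cover, since an uncovered classifier could be added to it.
  have hp : p (Nat.findGreatest p N) := Nat.findGreatest_spec (Nat.zero_le N) h0
  obtain ⟨F, hFH, hsep, hcard⟩ := hp
  refine ⟨F, hFH, hN F hFH hsep, fun h hh => ?_⟩
  by_contra! hfar
  have hnot : h ∉ F := by
    intro hmem
    have := hfar h hmem
    simp at this
    linarith
  have hsep' : ∀ f ∈ insert h F, ∀ f' ∈ insert h F, f ≠ f' →
      θ < P.real {x | f x ≠ f' x} := by
    intro f hf f' hf' hne
    rcases Finset.mem_insert.1 hf with h1 | h1 <;> rcases Finset.mem_insert.1 hf' with h2 | h2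
    · exact absurd (h1.trans h2.symm) hne
    · exact h1 ▸ hfar _ h2
    · simpa [ne_comm, h2] using hfar _ h1
    · exact hsep _ h1 _ h2 hne
  have hsub : ↑(insert h F) ⊆ H := by
    rw [Finset.coe_insert]
    exact Set.insert_subset hh hFH
  have hle := hN _ hsub hsep'
  rw [Finset.card_insert_of_notMem hnot] at hle
  have : F.card + 1 ≤ Nat.findGreatest p N :=
    Nat.le_findGreatest hle ⟨_, hsub, hsep', Finset.card_insert_of_notMem hnot⟩
  omega

end Cover

/-! ### Gibbs weights -/

section Gibbs

variable {ι : Type*} [Fintype ι]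

/-- The exponential weights `a i * exp (c * L i)`, normalised. -/
noncomputable def gibbs (a : ι → ℝ) (c : ℝ) (L : ι → ℝ) (i : ι) : ℝ :=
  a i * Real.exp (c * L i) / ∑ k, a k * Real.exp (c * L k)

theorem sum_mul_exp_pos {a : ι → ℝ} (ha : ∀ i, 0 ≤ a i) (hpos : 0 < ∑ i, a i) (c : ℝ) (L : ι → ℝ) :
    0 < ∑ i, a i * Real.exp (c * L i) := by
  obtain ⟨i, hi, h⟩ : ∃ i ∈ Finset.univ, 0 < a i := by
    by_contra! h
    exact absurd (Finset.sum_nonpos h) (not_le.2 hpos)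
  exact Finset.sum_pos' (fun j _ => mul_nonneg (ha j) (Real.exp_nonneg _))
    ⟨i, hi, mul_pos h (Real.exp_pos _)⟩

theorem gibbs_nonneg {a : ι → ℝ} (ha : ∀ i, 0 ≤ a i) (c : ℝ) (L : ι → ℝ) (i : ι) :
    0 ≤ gibbs a c L i :=
  div_nonneg (mul_nonneg (ha i) (Real.exp_nonneg _))
    (Finset.sum_nonneg fun j _ => mul_nonneg (ha j) (Real.exp_nonneg _))

theorem sum_gibbs {a : ι → ℝ} (ha : ∀ i, 0 ≤ a i) (hpos : 0 < ∑ i, a i) (c : ℝ) (L : ι → ℝ) :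
    ∑ i, gibbs a c L i = 1 := by
  unfold gibbs
  rw [← Finset.sum_div, div_self (sum_mul_exp_pos ha hpos c L).ne']

theorem measurable_gibbs {α : Type*} [MeasurableSpace α] {a L : α → ι → ℝ} (c : ℝ)
    (ha : Measurable a) (hL : Measurable L) : Measurable fun x => gibbs (a x) c (L x) := by
  unfold gibbs
  fun_prop

end Gibbs

theorem Measurable.eval_index {α ι : Type*} [MeasurableSpace α] [Fintype ι] [MeasurableSpace ι]
    [MeasurableSingletonClass ι] {f : α → ι → ℝ} {i : α → ι} (hf : Measurable f)
    (hi : Measurable i) : Measurable fun x => f x (i x) := by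
  classical
  have h : (fun x => f x (i x)) = fun x => ∑ k, if i x = k then f x k else 0 := by
    funext x
    simp
  rw [h]
  refine Finset.measurable_fun_sum _ fun k _ => Measurable.ite ?_ (by fun_prop) measurable_const
  exact hi (measurableSet_singleton k)

/-! ### Sampling an index -/

section WeightKernel

variable {α : Type*} [MeasurableSpace α] {n : ℕ}

/-- The kernel that draws `i` with probability `w x i`. -/
noncomputable def weightKernel (w : α → Fin n → ℝ) (hw : Measurable w) : Kernel α (Fin n) where
  toFun x := ∑ i, ENNReal.ofReal (w x i) • Measure.dirac i
  measurable' := by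
    refine Measure.measurable_of_measurable_coe _ fun s _ => ?_
    simp only [Measure.finsetSum_apply, Measure.smul_apply, smul_eq_mul]
    fun_prop

theorem lintegral_weightKernel (w : α → Fin n → ℝ) (hw : Measurable w) (x : α)
    (f : Fin n → ℝ≥0∞) :
    ∫⁻ i, f i ∂(weightKernel w hw x) = ∑ i, ENNReal.ofReal (w x i) * f i := by
  change ∫⁻ i, f i ∂(∑ i, ENNReal.ofReal (w x i) • Measure.dirac i) = _
  simp [lintegral_finsetSum_measure, lintegral_smul_measure]

theorem isMarkovKernel_weightKernel (w : α → Fin n → ℝ) (hw : Measurable w)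
    (h0 : ∀ x i, 0 ≤ w x i) (h1 : ∀ x, ∑ i, w x i = 1) : IsMarkovKernel (weightKernel w hw) := by
  refine ⟨fun x => ⟨?_⟩⟩
  have h := lintegral_weightKernel w hw x 1
  simp only [Pi.one_apply, lintegral_one, mul_one] at h
  rw [h, ← ENNReal.ofReal_sum_of_nonneg fun i _ => h0 x i, h1, ENNReal.ofReal_one]

end WeightKernel

/-! ### The law of a transcript -/

section Law

variable {X : Type*} [MeasurableSpace X] {n : ℕ}

theorem lintegral_law_succ {H : Set (X → Bool)} {m : ℕ} (A : Algorithm H n m)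
    (D : Fin n → ProbabilityMeasure (X × Bool)) (t : ℕ) {F : Transcript X n (t + 1) → ℝ≥0∞}
    (hF : Measurable F) :
    ∫⁻ τ, F τ ∂A.law D (t + 1) = ∫⁻ τ, ∫⁻ i, ∫⁻ z, F (Fin.snoc τ (i, z))
      ∂(D i : Measure (X × Bool)) ∂A.query t τ ∂A.law D t := by
  have := A.isMarkov t
  have hF' : Measurable fun p : Transcript X n t × (Fin n × (X × Bool)) =>
      F (Fin.snoc p.1 p.2) := hF.comp (measurable_snoc t)
  rw [Algorithm.law, lintegral_map hF (measurable_snoc t), Measure.lintegral_compProd hF']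
  refine lintegral_congr fun τ => ?_
  exact Kernel.lintegral_compProd _ _ _ (hF'.comp measurable_prodMk_left)

/-- The first `m₁` calls of a transcript. -/
def initial {X : Type*} {n m₁ s : ℕ} (h : m₁ ≤ s) (τ : Transcript X n s) : Transcript X n m₁ :=
  fun j => τ (Fin.castLE h j)

theorem measurable_initial {m₁ s : ℕ} (h : m₁ ≤ s) :
    Measurable (initial h : Transcript X n s → Transcript X n m₁) :=
  measurable_pi_lambda _ fun _ => measurable_pi_apply _

theorem initial_snoc {X : Type*} {n m₁ s : ℕ} (h : m₁ ≤ s) (τ : Transcript X n s) (a : Fin n × (X × Bool)) :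
    initial (h.trans (Nat.le_succ s)) (Fin.snoc τ a : Transcript X n (s + 1)) = initial h τ := by
  funext j
  exact Fin.snoc_castSucc (α := fun _ => Fin n × (X × Bool)) a τ (Fin.castLE h j)

end Law

/-! ### The two-phase scheme -/

/-- Parameters of the learning algorithm: the first `m₁` calls determine hypotheses `hyp S j` with
prior weights `prior S j`; `β` and `γ` are the learning rates of the adversary, who picks a data
distribution, and of the learner, who picks a hypothesis. -/
structure Scheme {X : Type*} [MeasurableSpace X] (H : Set (X → Bool)) (n m₁ : ℕ)
    (J : Type*) [Fintype J] where
  hyp : Transcript X n m₁ → J → X → Bool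
  prior : Transcript X n m₁ → J → ℝ
  mem : ∀ S j, hyp S j ∈ H
  measurable_hyp : ∀ j, Measurable fun p : Transcript X n m₁ × X => hyp p.1 j p.2
  measurable_prior : Measurable prior
  prior_nonneg : ∀ S j, 0 ≤ prior S j
  prior_pos : ∀ S, 0 < ∑ j, prior S j
  g : Bool → Bool → ℝ
  g_mem : ∀ a b, g a b ∈ Set.Icc (0 : ℝ) 1
  n_pos : 0 < n
  β : ℝ
  γ : ℝ

/-- The state of the game: cumulative losses of the hypotheses, cumulative gains of the data
distributions, and the sum of the learner's mixed strategies. -/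
abbrev State (n : ℕ) (J : Type*) := (J → ℝ) × (Fin n → ℝ) × (J → ℝ)

namespace Scheme

variable {X : Type*} [MeasurableSpace X] {H : Set (X → Bool)} {n m₁ : ℕ} {J : Type*} [Fintype J]
  (E : Scheme H n m₁ J)

/-- The loss of hypothesis `j` on an example. -/
def loss (S : Transcript X n m₁) (z : X × Bool) (j : J) : ℝ := E.g (E.hyp S j z.1) z.2

/-- The learner's mixed strategy. -/
noncomputable def learner (S : Transcript X n m₁) (σ : State n J) : J → ℝ :=
  gibbs (E.prior S) (-E.γ) σ.1

/-- The adversary's mixed strategy. -/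
noncomputable def adversary (σ : State n J) : Fin n → ℝ := gibbs 1 E.β σ.2.1

/-- The sampling distribution: the adversary's strategy mixed with uniform exploration. -/
noncomputable def mix (σ : State n J) (i : Fin n) : ℝ := (E.adversary σ i + 1 / n) / 2

/-- The importance weight of a draw from the `i`-th data distribution. -/
noncomputable def ratio (σ : State n J) (i : Fin n) : ℝ := E.adversary σ i / E.mix σ i

/-- The learner's expected loss on an example. -/
noncomputable def mixLoss (S : Transcript X n m₁) (σ : State n J) (z : X × Bool) : ℝ :=
  ∑ j, E.learner S σ j * E.loss S z j

/-- The estimated gain of the `k`-th data distribution after a draw `a`. -/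
noncomputable def gain (S : Transcript X n m₁) (σ : State n J) (a : Fin n × (X × Bool))
    (k : Fin n) : ℝ := if a.1 = k then E.mixLoss S σ a.2 / E.mix σ k else 0

/-- The state after one more call. -/
noncomputable def step (S : Transcript X n m₁) (σ : State n J) (a : Fin n × (X × Bool)) :
    State n J :=
  (fun j => σ.1 j + E.ratio σ a.1 * E.loss S a.2 j, fun k => σ.2.1 k + E.gain S σ a k,
    fun j => σ.2.2 j + E.learner S σ j)

/-- The state after `s` calls, of which the first `m₁` are not played. -/
noncomputable def state (S : Transcript X n m₁) : (s : ℕ) → Transcript X n s → State n J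
  | 0, _ => 0
  | s + 1, τ => if s < m₁ then 0 else E.step S (state S s (Fin.init τ)) (τ (Fin.last s))

theorem state_of_le (S : Transcript X n m₁) {s : ℕ} (h : s ≤ m₁) (τ : Transcript X n s) :
    E.state S s τ = 0 := by
  cases s with
  | zero => rfl
  | succ s => rw [state, if_pos (by omega)]

theorem state_snoc (S : Transcript X n m₁) {s : ℕ} (h : m₁ ≤ s) (τ : Transcript X n s)
    (a : Fin n × (X × Bool)) :
    E.state S (s + 1) (Fin.snoc τ a : Transcript X n (s + 1)) = E.step S (E.state S s τ) a := by
  rw [state, if_neg (by omega), Fin.init_snoc, Fin.snoc_last]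

/-! #### Bounds -/

theorem loss_mem (S : Transcript X n m₁) (z : X × Bool) (j : J) :
    E.loss S z j ∈ Set.Icc (0 : ℝ) 1 := E.g_mem _ _

theorem learner_nonneg (S : Transcript X n m₁) (σ : State n J) (j : J) :
    0 ≤ E.learner S σ j := gibbs_nonneg (E.prior_nonneg S) _ _ _

theorem sum_learner (S : Transcript X n m₁) (σ : State n J) : ∑ j, E.learner S σ j = 1 :=
  sum_gibbs (E.prior_nonneg S) (E.prior_pos S) _ _

theorem cast_pos (E : Scheme H n m₁ J) : (0 : ℝ) < n := Nat.cast_pos.2 E.n_pos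

theorem adversary_nonneg (σ : State n J) (i : Fin n) : 0 ≤ E.adversary σ i :=
  gibbs_nonneg (fun _ => zero_le_one) _ _ _

theorem sum_adversary (σ : State n J) : ∑ i, E.adversary σ i = 1 :=
  sum_gibbs (fun _ => zero_le_one) (by simpa using E.n_pos) _ _

theorem mix_pos (σ : State n J) (i : Fin n) : 0 < E.mix σ i := by
  have h1 := E.adversary_nonneg σ i
  have h2 : (0 : ℝ) < 1 / n := one_div_pos.2 E.cast_pos
  unfold mix
  linarith

/-- Uniform exploration keeps every sampling probability at least `1 / (2n)`. This caps the gain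
estimates and forces the adversary's rate down to order `ε / n`. -/
theorem inv_mix_le (σ : State n J) (i : Fin n) : 1 / E.mix σ i ≤ 2 * n := by
  rw [div_le_iff₀ (E.mix_pos σ i), mix]
  have h1 := E.adversary_nonneg σ i
  have h3 := E.cast_pos
  have h4 : 2 * (n : ℝ) * ((E.adversary σ i + 1 / n) / 2) = n * E.adversary σ i + 1 := by
    field_simp
  rw [h4]
  nlinarith

theorem sum_mix (σ : State n J) : ∑ i, E.mix σ i = 1 := by
  unfold mix
  have := E.cast_pos.ne'
  rw [← Finset.sum_div, Finset.sum_add_distrib, E.sum_adversary]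
  simp [this]

theorem ratio_nonneg (σ : State n J) (i : Fin n) : 0 ≤ E.ratio σ i :=
  div_nonneg (E.adversary_nonneg σ i) (E.mix_pos σ i).le

/-- Half of the sampling law is the adversary's own strategy. The learner's estimated losses are
therefore bounded independently of `n`, which keeps the factor `n` away from the complexity of the
class. -/
theorem ratio_le (σ : State n J) (i : Fin n) : E.ratio σ i ≤ 2 := by
  rw [ratio, div_le_iff₀ (E.mix_pos σ i), mix]
  have : (0 : ℝ) < 1 / n := one_div_pos.2 E.cast_pos
  linarith

theorem mix_mul_ratio (σ : State n J) (i : Fin n) : E.mix σ i * E.ratio σ i = E.adversary σ i :=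
  mul_div_cancel₀ _ (E.mix_pos σ i).ne'

theorem mixLoss_mem (S : Transcript X n m₁) (σ : State n J) (z : X × Bool) :
    E.mixLoss S σ z ∈ Set.Icc (0 : ℝ) 1 := by
  constructor
  · exact Finset.sum_nonneg fun j _ => mul_nonneg (E.learner_nonneg S σ j) (E.loss_mem S z j).1
  · rw [← E.sum_learner S σ]
    exact Finset.sum_le_sum fun j _ =>
      mul_le_of_le_one_right (E.learner_nonneg S σ j) (E.loss_mem S z j).2

/-! #### Measurability -/

theorem measurable_loss : Measurable fun p : Transcript X n m₁ × (X × Bool) => E.loss p.1 p.2 := by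
  refine measurable_pi_lambda _ fun j => ?_
  have h : Measurable fun p : Bool × Bool => E.g p.1 p.2 := measurable_of_countable _
  exact h.comp (((E.measurable_hyp j).comp (measurable_fst.prodMk
    (measurable_fst.comp measurable_snd))).prodMk (measurable_snd.comp measurable_snd))

theorem measurable_learner :
    Measurable fun p : Transcript X n m₁ × State n J => E.learner p.1 p.2 :=
  measurable_gibbs _ (E.measurable_prior.comp measurable_fst)
    (measurable_fst.comp measurable_snd)

theorem measurable_adversary : Measurable (E.adversary : State n J → Fin n → ℝ) :=
  measurable_gibbs _ measurable_const (measurable_fst.comp measurable_snd)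

theorem measurable_mix : Measurable (E.mix : State n J → Fin n → ℝ) := by
  have := E.measurable_adversary
  unfold mix
  fun_prop

theorem measurable_mixLoss :
    Measurable fun p : (Transcript X n m₁ × State n J) × (X × Bool) =>
      E.mixLoss p.1.1 p.1.2 p.2 := by
  have h1 := E.measurable_learner.comp (measurable_fst :
    Measurable fun p : (Transcript X n m₁ × State n J) × (X × Bool) => p.1)
  have h2 := E.measurable_loss.comp ((measurable_fst.comp measurable_fst).prodMk measurable_snd :
    Measurable fun p : (Transcript X n m₁ × State n J) × (X × Bool) => (p.1.1, p.2))
  exact Finset.measurable_fun_sum _ fun j _ =>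
    ((measurable_pi_apply j).comp h1).mul ((measurable_pi_apply j).comp h2)

theorem measurable_step :
    Measurable fun p : (Transcript X n m₁ × State n J) × (Fin n × (X × Bool)) =>
      E.step p.1.1 p.1.2 p.2 := by
  have hidx : Measurable fun p : (Transcript X n m₁ × State n J) × (Fin n × (X × Bool)) =>
      p.2.1 := by fun_prop
  have hmix : Measurable fun p : (Transcript X n m₁ × State n J) × (Fin n × (X × Bool)) =>
      E.mix p.1.2 := E.measurable_mix.comp (by fun_prop)
  have hadv : Measurable fun p : (Transcript X n m₁ × State n J) × (Fin n × (X × Bool)) =>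
      E.adversary p.1.2 := E.measurable_adversary.comp (by fun_prop)
  have hloss : Measurable fun p : (Transcript X n m₁ × State n J) × (Fin n × (X × Bool)) =>
      E.loss p.1.1 p.2.2 := E.measurable_loss.comp
        (g := fun p : Transcript X n m₁ × (X × Bool) => E.loss p.1 p.2)
        (f := fun p : (Transcript X n m₁ × State n J) × (Fin n × (X × Bool)) =>
          (p.1.1, p.2.2)) (by fun_prop)
  have hml : Measurable fun p : (Transcript X n m₁ × State n J) × (Fin n × (X × Bool)) =>
      E.mixLoss p.1.1 p.1.2 p.2.2 := E.measurable_mixLoss.comp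
        (g := fun p : (Transcript X n m₁ × State n J) × (X × Bool) => E.mixLoss p.1.1 p.1.2 p.2)
        (f := fun p : (Transcript X n m₁ × State n J) × (Fin n × (X × Bool)) =>
          (p.1, p.2.2)) (by fun_prop)
  have hlearn : Measurable fun p : (Transcript X n m₁ × State n J) × (Fin n × (X × Bool)) =>
      E.learner p.1.1 p.1.2 := E.measurable_learner.comp measurable_fst
  have hratio := (Measurable.eval_index hadv hidx).div (Measurable.eval_index hmix hidx)
  refine Measurable.prodMk ?_ (Measurable.prodMk ?_ ?_)
  · refine measurable_pi_lambda _ fun j => Measurable.add (by fun_prop) ?_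
    exact hratio.mul ((measurable_pi_apply j).comp hloss)
  · refine measurable_pi_lambda _ fun k => Measurable.add (by fun_prop) ?_
    refine Measurable.ite (hidx (measurableSet_singleton k)) ?_ measurable_const
    exact hml.div ((measurable_pi_apply k).comp hmix)
  · refine measurable_pi_lambda _ fun j => Measurable.add (by fun_prop) ?_
    exact (measurable_pi_apply j).comp hlearn

theorem measurable_state (s : ℕ) :
    Measurable fun p : Transcript X n m₁ × Transcript X n s => E.state p.1 s p.2 := by
  induction s with
  | zero => exact measurable_const
  | succ s ih =>
    by_cases h : s < m₁
    · simp only [state, h, if_true]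
      exact measurable_const
    · simp only [state, h, if_false]
      have h1 : Measurable fun p : Transcript X n m₁ × Transcript X n (s + 1) =>
          E.state p.1 s (Fin.init p.2) := by
        refine ih.comp (measurable_fst.prodMk ?_)
        exact measurable_pi_lambda _ fun j => (measurable_pi_apply _).comp measurable_snd
      exact E.measurable_step.comp ((measurable_fst.prodMk h1).prodMk
        ((measurable_pi_apply _).comp measurable_snd))

theorem measurable_state_initial {s : ℕ} (h : m₁ ≤ s) :
    Measurable fun τ : Transcript X n s => E.state (initial h τ) s τ :=
  (E.measurable_state s).comp ((measurable_initial h).prodMk measurable_id)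

/-! #### The algorithm -/

/-- The law of call number `s`. -/
noncomputable def query (s : ℕ) (τ : Transcript X n s) (i : Fin n) : ℝ :=
  if h : m₁ ≤ s then E.mix (E.state (initial h τ) s τ) i else 1 / n

theorem measurable_query (s : ℕ) : Measurable (E.query s) := by
  unfold query
  by_cases h : m₁ ≤ s
  · simp only [h, dif_pos]
    exact E.measurable_mix.comp (E.measurable_state_initial h)
  · simp only [h, dif_neg, not_false_eq_true]
    exact measurable_const

theorem query_nonneg (s : ℕ) (τ : Transcript X n s) (i : Fin n) : 0 ≤ E.query s τ i := by
  unfold query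
  split_ifs
  · exact (E.mix_pos _ _).le
  · positivity

theorem sum_query (s : ℕ) (τ : Transcript X n s) : ∑ i, E.query s τ i = 1 := by
  unfold query
  split_ifs
  · exact E.sum_mix _
  · simp [E.cast_pos.ne']

theorem query_of_lt {s : ℕ} (h : s < m₁) (τ : Transcript X n s) (i : Fin n) :
    E.query s τ i = 1 / n := by
  rw [query, dif_neg (by omega)]

theorem learnerSum_nonneg (S : Transcript X n m₁) (s : ℕ) (τ : Transcript X n s) (j : J) :
    0 ≤ (E.state S s τ).2.2 j := by
  induction s with
  | zero => exact le_rfl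
  | succ s ih =>
    rw [state]
    split_ifs
    · exact le_rfl
    · exact add_nonneg (ih _) (E.learner_nonneg _ _ _)

theorem sum_learnerSum (S : Transcript X n m₁) (t : ℕ) (τ : Transcript X n (m₁ + t)) :
    ∑ j, (E.state S (m₁ + t) τ).2.2 j = t := by
  induction t with
  | zero => simp [E.state_of_le S le_rfl]
  | succ t ih =>
    change ∑ j, (E.state S (m₁ + t + 1) τ).2.2 j = _
    rw [state, if_neg (by omega)]
    simp only [step, Finset.sum_add_distrib, E.sum_learner, ih]
    simp

/-- The learner's average strategy over the played rounds. -/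
noncomputable def average (T : ℕ) (hT : 0 < T) (τ : Transcript X n (m₁ + T)) : PMF J :=
  PMF.ofFintype (fun j => ENNReal.ofReal
    ((E.state (initial (Nat.le_add_right m₁ T) τ) (m₁ + T) τ).2.2 j / T)) (by
      rw [← ENNReal.ofReal_sum_of_nonneg fun j _ =>
        div_nonneg (E.learnerSum_nonneg _ _ _ _) (Nat.cast_nonneg T), ← Finset.sum_div,
        E.sum_learnerSum, div_self (Nat.cast_pos.2 hT).ne', ENNReal.ofReal_one])

/-- The randomized classifier that draws a hypothesis from the learner's average strategy. -/
noncomputable def output (T : ℕ) (hT : 0 < T) (τ : Transcript X n (m₁ + T)) : PMF (X → Bool) :=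
  (E.average T hT τ).map (E.hyp (initial (Nat.le_add_right m₁ T) τ))

/-- The learning algorithm with `m₁` preliminary calls and `T` rounds of play. -/
noncomputable def algorithm (T : ℕ) (hT : 0 < T) : Algorithm H n (m₁ + T) where
  query s := weightKernel (E.query s) (E.measurable_query s)
  isMarkov s := isMarkovKernel_weightKernel _ _ (E.query_nonneg s) (E.sum_query s)
  output := E.output T hT
  output_support τ := by
    intro f hf
    rw [output, PMF.support_map] at hf
    obtain ⟨j, -, rfl⟩ := hf
    exact E.mem _ _
  measurable_output := by
    have h : ∀ p : Transcript X n (m₁ + T) × X,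
        ((E.output T hT p.1).map fun f => f p.2) true = ∑ j,
          ENNReal.ofReal ((E.state (initial (Nat.le_add_right m₁ T) p.1) (m₁ + T) p.1).2.2 j / T) *
            (if E.hyp (initial (Nat.le_add_right m₁ T) p.1) j p.2 = true then 1 else 0) := by
      intro p
      rw [output, PMF.map_comp, PMF.map_apply, tsum_fintype]
      refine Finset.sum_congr rfl fun j _ => ?_
      simp only [average, PMF.ofFintype_apply, Function.comp_apply, mul_ite, mul_one, mul_zero]
      congr 1
      exact propext eq_comm
    simp_rw [h]
    have hs : Measurable fun p : Transcript X n (m₁ + T) × X =>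
        E.state (initial (Nat.le_add_right m₁ T) p.1) (m₁ + T) p.1 :=
      (E.measurable_state_initial _).comp measurable_fst
    refine Finset.measurable_fun_sum _ fun j _ => Measurable.mul ?_ ?_
    · fun_prop
    · refine Measurable.ite ?_ measurable_const measurable_const
      exact (E.measurable_hyp j).comp (((measurable_initial _).comp measurable_fst).prodMk
        measurable_snd) (measurableSet_singleton true)

theorem lintegral_law_succ (T : ℕ) (hT : 0 < T) (D : Fin n → ProbabilityMeasure (X × Bool)) (s : ℕ)
    {F : Transcript X n (s + 1) → ℝ≥0∞} (hF : Measurable F) :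
    ∫⁻ τ, F τ ∂(E.algorithm T hT).law D (s + 1) =
      ∫⁻ τ, ∑ i, ENNReal.ofReal (E.query s τ i) *
        ∫⁻ z, F (Fin.snoc τ (i, z)) ∂(D i : Measure (X × Bool)) ∂(E.algorithm T hT).law D s := by
  rw [CollabLearning.lintegral_law_succ _ _ _ hF]
  exact lintegral_congr fun τ => lintegral_weightKernel _ (E.measurable_query s) _ _

/-- A function of the state that grows in conditional mean by at most a factor `C` per round. -/
theorem lintegral_le_pow_mul (T : ℕ) (hT : 0 < T) (D : Fin n → ProbabilityMeasure (X × Bool))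
    (Ψ : Transcript X n m₁ → State n J → ℝ≥0∞)
    (hΨ : Measurable fun p : Transcript X n m₁ × State n J => Ψ p.1 p.2) (C : ℝ≥0∞)
    (hstep : ∀ S σ, ∑ i, ENNReal.ofReal (E.mix σ i) *
      ∫⁻ z, Ψ S (E.step S σ (i, z)) ∂(D i : Measure (X × Bool)) ≤ C * Ψ S σ) (t : ℕ) :
    ∫⁻ τ, Ψ (initial (Nat.le_add_right m₁ t) τ)
        (E.state (initial (Nat.le_add_right m₁ t) τ) (m₁ + t) τ)
        ∂(E.algorithm T hT).law D (m₁ + t) ≤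
      C ^ t * ∫⁻ S, Ψ S 0 ∂(E.algorithm T hT).law D m₁ := by
  have hmeas : ∀ t, Measurable fun τ : Transcript X n (m₁ + t) =>
      Ψ (initial (Nat.le_add_right m₁ t) τ)
        (E.state (initial (Nat.le_add_right m₁ t) τ) (m₁ + t) τ) := fun t =>
    hΨ.comp ((measurable_initial _).prodMk (E.measurable_state_initial _))
  induction t with
  | zero =>
    rw [pow_zero, one_mul]
    refine lintegral_mono fun τ => ?_
    exact (congrArg (Ψ τ) (E.state_of_le τ le_rfl τ)).le
  | succ t ih =>
    refine (E.lintegral_law_succ T hT D (m₁ + t) (hmeas (t + 1))).le.trans ?_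
    calc _ ≤ ∫⁻ τ, C * Ψ (initial (Nat.le_add_right m₁ t) τ)
          (E.state (initial (Nat.le_add_right m₁ t) τ) (m₁ + t) τ)
          ∂(E.algorithm T hT).law D (m₁ + t) := by
          refine lintegral_mono fun τ => ?_
          refine le_trans (le_of_eq ?_) (hstep _ _)
          refine Finset.sum_congr rfl fun i _ => ?_
          rw [query, dif_pos (Nat.le_add_right m₁ t)]
          congr 1
          refine lintegral_congr fun z => ?_
          -- A new call leaves the preliminary sample, and hence the hypotheses and the prior,
          -- unchanged.
          have h1 := initial_snoc (Nat.le_add_right m₁ t) τ (i, z)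
          rw [← E.state_snoc _ (Nat.le_add_right m₁ t), ← h1]
          rfl
      _ ≤ C ^ (t + 1) * ∫⁻ S, Ψ S 0 ∂(E.algorithm T hT).law D m₁ := by
          rw [lintegral_const_mul _ (hmeas t), pow_succ', mul_assoc]
          gcongr

end Scheme

/-! ### Exponential inequalities -/

theorem exp_le_one_add_add_sq {x : ℝ} (hx : |x| ≤ 1) : Real.exp x ≤ 1 + x + x ^ 2 := by
  have := (abs_le.1 (Real.abs_exp_sub_one_sub_id_le hx)).2
  linarith

/-- The one-step inequality for exponential weights. -/
theorem log_sum_update_le {ι : Type*} [Fintype ι] {a : ι → ℝ} (ha : ∀ i, 0 ≤ a i)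
    (hpos : 0 < ∑ i, a i) (c : ℝ) (L u : ι → ℝ) (hu : ∀ i, |c * u i| ≤ 1) :
    Real.log (∑ i, a i * Real.exp (c * (L i + u i))) ≤
      Real.log (∑ i, a i * Real.exp (c * L i)) + c * ∑ i, gibbs a c L i * u i +
        c ^ 2 * ∑ i, gibbs a c L i * u i ^ 2 := by
  set W := ∑ i, a i * Real.exp (c * L i) with hW
  have hWpos : 0 < W := sum_mul_exp_pos ha hpos c L
  set r := c * ∑ i, gibbs a c L i * u i + c ^ 2 * ∑ i, gibbs a c L i * u i ^ 2 with hr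
  -- The quotient of consecutive partition functions is the Gibbs mean of `exp (c * u)`. It is
  -- bounded by `exp x ≤ 1 + x + x ^ 2` and then `1 + r ≤ exp r`.
  have h : ∑ i, a i * Real.exp (c * (L i + u i)) ≤ W * Real.exp r := by
    calc ∑ i, a i * Real.exp (c * (L i + u i))
        = W * ∑ i, gibbs a c L i * Real.exp (c * u i) := by
          rw [Finset.mul_sum]
          refine Finset.sum_congr rfl fun i _ => ?_
          rw [gibbs, ← hW, mul_add, Real.exp_add]
          field_simp
      _ ≤ W * ∑ i, gibbs a c L i * (1 + c * u i + (c * u i) ^ 2) := by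
          refine mul_le_mul_of_nonneg_left (Finset.sum_le_sum fun i _ => ?_) hWpos.le
          exact mul_le_mul_of_nonneg_left (exp_le_one_add_add_sq (hu i)) (gibbs_nonneg ha _ _ _)
      _ = W * (1 + r) := by
          congr 1
          have : ∀ i, gibbs a c L i * (1 + c * u i + (c * u i) ^ 2) = gibbs a c L i +
              c * (gibbs a c L i * u i) + c ^ 2 * (gibbs a c L i * u i ^ 2) := fun i => by ring
          simp_rw [this]
          rw [Finset.sum_add_distrib, Finset.sum_add_distrib, sum_gibbs ha hpos,
            ← Finset.mul_sum, ← Finset.mul_sum, hr]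
          ring
      _ ≤ W * Real.exp r := by
          refine mul_le_mul_of_nonneg_left ?_ hWpos.le
          linarith [Real.add_one_le_exp r]
  calc Real.log (∑ i, a i * Real.exp (c * (L i + u i))) ≤ Real.log (W * Real.exp r) :=
        Real.log_le_log (sum_mul_exp_pos ha hpos c fun i => L i + u i) h
    _ = Real.log W + r := by rw [Real.log_mul hWpos.ne' (Real.exp_pos _).ne', Real.log_exp]
    _ = _ := by rw [hr]; ring

theorem lintegral_exp_le {Z : Type*} [MeasurableSpace Z] (μ : Measure Z) [IsProbabilityMeasure μ]
    {f : Z → ℝ} (hf : Measurable f) (h1 : ∀ z, |f z| ≤ 1) :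
    ∫⁻ z, ENNReal.ofReal (Real.exp (f z)) ∂μ ≤
      ENNReal.ofReal (1 + ∫ z, f z ∂μ + ∫ z, f z ^ 2 ∂μ) := by
  have i1 : Integrable f μ := Integrable.of_bound hf.aestronglyMeasurable 1
    (Filter.Eventually.of_forall h1)
  have i2 : Integrable (fun z => f z ^ 2) μ :=
    Integrable.of_bound (hf.pow_const 2).aestronglyMeasurable 1
      (Filter.Eventually.of_forall fun z => by
        rw [norm_pow]
        exact pow_le_one₀ (norm_nonneg _) (h1 z))
  have i3 : Integrable (fun z => 1 + f z) μ := (integrable_const 1).add i1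
  calc ∫⁻ z, ENNReal.ofReal (Real.exp (f z)) ∂μ
      ≤ ∫⁻ z, ENNReal.ofReal (1 + f z + f z ^ 2) ∂μ :=
        lintegral_mono fun z => ENNReal.ofReal_le_ofReal (exp_le_one_add_add_sq (h1 z))
    _ = ENNReal.ofReal (∫ z, (1 + f z + f z ^ 2) ∂μ) := by
        refine (ofReal_integral_eq_lintegral_ofReal (f := fun z => 1 + f z + f z ^ 2)
          (i3.add i2) ?_).symm
        exact Filter.Eventually.of_forall fun z =>
          (Real.exp_nonneg _).trans (exp_le_one_add_add_sq (h1 z))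
    _ = _ := by
        rw [integral_add i3 i2, integral_add (integrable_const 1) i1]
        simp

/-- Exponential moments of a bounded function of a draw from a mixture. -/
theorem sum_lintegral_exp_le {Z : Type*} [MeasurableSpace Z] {n : ℕ} (μ : Fin n → Measure Z)
    [∀ i, IsProbabilityMeasure (μ i)] {w : Fin n → ℝ} (hw : ∀ i, 0 ≤ w i) (hw1 : ∑ i, w i = 1)
    {f : Fin n → Z → ℝ} (hf : ∀ i, Measurable (f i)) (h1 : ∀ i z, |f i z| ≤ 1) {c : ℝ}
    (hc : ∑ i, w i * (∫ z, f i z ∂μ i + ∫ z, f i z ^ 2 ∂μ i) ≤ c) :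
    ∑ i, ENNReal.ofReal (w i) * ∫⁻ z, ENNReal.ofReal (Real.exp (f i z)) ∂μ i ≤
      ENNReal.ofReal (Real.exp c) := by
  -- Nonnegativity is needed to move the sum inside `ENNReal.ofReal`; it holds because the mean of
  -- `f i` is at least `-1`.
  have hnn : ∀ i, 0 ≤ 1 + ∫ z, f i z ∂μ i + ∫ z, f i z ^ 2 ∂μ i := by
    intro i
    have h2 : |∫ z, f i z ∂μ i| ≤ 1 := by
      simpa using norm_integral_le_of_norm_le_const (μ := μ i) (f := f i) (C := 1)
        (Filter.Eventually.of_forall (h1 i))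
    have h3 : 0 ≤ ∫ z, f i z ^ 2 ∂μ i := integral_nonneg fun z => sq_nonneg _
    linarith [(abs_le.1 h2).1]
  calc _ ≤ ∑ i, ENNReal.ofReal (w i) *
        ENNReal.ofReal (1 + ∫ z, f i z ∂μ i + ∫ z, f i z ^ 2 ∂μ i) := by
        gcongr with i
        exact lintegral_exp_le (μ i) (hf i) (h1 i)
    _ = ENNReal.ofReal (∑ i, w i * (1 + ∫ z, f i z ∂μ i + ∫ z, f i z ^ 2 ∂μ i)) := by
        rw [ENNReal.ofReal_sum_of_nonneg fun i _ => mul_nonneg (hw i) (hnn i)]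
        exact Finset.sum_congr rfl fun i _ => (ENNReal.ofReal_mul (hw i)).symm
    _ ≤ ENNReal.ofReal (Real.exp c) := by
        refine ENNReal.ofReal_le_ofReal ?_
        have : ∑ i, w i * (1 + ∫ z, f i z ∂μ i + ∫ z, f i z ^ 2 ∂μ i) =
            1 + ∑ i, w i * (∫ z, f i z ∂μ i + ∫ z, f i z ^ 2 ∂μ i) := by
          nth_rewrite 2 [← hw1]
          rw [← Finset.sum_add_distrib]
          exact Finset.sum_congr rfl fun i _ => by ring
        rw [this]
        linarith [Real.add_one_le_exp c]

/-! ### Analysis of the scheme -/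

namespace Scheme

variable {X : Type*} [MeasurableSpace X] {H : Set (X → Bool)} {n m₁ : ℕ} {J : Type*} [Fintype J]
  (E : Scheme H n m₁ J)

/-- The joint potential of the adversary and the learner. -/
noncomputable def potential (S : Transcript X n m₁) (σ : State n J) : ℝ :=
  Real.log (∑ i, (1 : Fin n → ℝ) i * Real.exp (E.β * σ.2.1 i)) / E.β +
    Real.log (∑ j, E.prior S j * Real.exp (-E.γ * σ.1 j)) / E.γ

/-- The first-order change is `ratio * mixLoss` for the adversary and its negative for the learner,
on the same draw. They cancel exactly, whatever the draw, and only the second-order terms remain; so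
the bound needs no probability. -/
theorem potential_step_le (hβ : 0 < E.β) (hβ1 : 2 * n * E.β ≤ 1) (hγ : 0 < E.γ)
    (hγ1 : 2 * E.γ ≤ 1) (S : Transcript X n m₁) (σ : State n J) (a : Fin n × (X × Bool)) :
    E.potential S (E.step S σ a) ≤ E.potential S σ + (4 * n * E.β + 4 * E.γ) := by
  obtain ⟨i, z⟩ := a
  have hn := E.cast_pos
  obtain ⟨hl0, hl1⟩ := E.mixLoss_mem S σ z
  have hmix := E.mix_pos σ i
  have hinv := E.inv_mix_le σ i
  have hr0 := E.ratio_nonneg σ i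
  have hr2 := E.ratio_le σ i
  have hgain : ∀ k, 0 ≤ E.gain S σ (i, z) k ∧ E.gain S σ (i, z) k ≤ 2 * n := by
    intro k
    unfold gain
    split_ifs with h
    · subst h
      refine ⟨div_nonneg hl0 hmix.le, le_trans ?_ hinv⟩
      exact div_le_div_of_nonneg_right hl1 hmix.le
    · exact ⟨le_rfl, by positivity⟩
  have adv := log_sum_update_le (a := (1 : Fin n → ℝ)) (fun _ => zero_le_one)
    (by simpa using E.n_pos) E.β σ.2.1 (E.gain S σ (i, z)) (by
      intro k
      obtain ⟨h0, h1⟩ := hgain k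
      rw [abs_of_nonneg (mul_nonneg hβ.le h0)]
      calc E.β * E.gain S σ (i, z) k ≤ E.β * (2 * n) := mul_le_mul_of_nonneg_left h1 hβ.le
        _ ≤ 1 := by linarith)
  have hadv1 : ∑ k, gibbs 1 E.β σ.2.1 k * E.gain S σ (i, z) k =
      E.ratio σ i * E.mixLoss S σ z := by
    simp only [gain, mul_ite, mul_zero, Finset.sum_ite_eq, Finset.mem_univ, if_true]
    unfold ratio adversary
    ring
  -- Only the sampled index contributes. One factor `1 / mix` joins the adversary's weight to form
  -- `ratio ≤ 2`, and the other costs `2 * n`, so the second moment is linear in `n` and not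
  -- quadratic.
  have hadv2 : ∑ k, gibbs 1 E.β σ.2.1 k * E.gain S σ (i, z) k ^ 2 ≤ 4 * n := by
    simp only [gain, ite_pow, mul_ite, ne_eq, OfNat.ofNat_ne_zero, not_false_eq_true, zero_pow,
      mul_zero, Finset.sum_ite_eq, Finset.mem_univ, if_true]
    have h : gibbs 1 E.β σ.2.1 i * (E.mixLoss S σ z / E.mix σ i) ^ 2 =
        E.ratio σ i * (1 / E.mix σ i) * E.mixLoss S σ z ^ 2 := by
      unfold ratio adversary
      field_simp
    rw [h]
    calc E.ratio σ i * (1 / E.mix σ i) * E.mixLoss S σ z ^ 2 ≤ 2 * (2 * n) * 1 := by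
          have := pow_le_one₀ (n := 2) hl0 hl1
          have h0 : 0 ≤ 1 / E.mix σ i := by positivity
          gcongr
      _ = 4 * n := by ring
  have lrn := log_sum_update_le (E.prior_nonneg S) (E.prior_pos S) (-E.γ) σ.1
    (fun j => E.ratio σ i * E.loss S z j) (by
      intro j
      obtain ⟨h0, h1⟩ := E.loss_mem S z j
      rw [neg_mul, abs_neg, abs_of_nonneg (mul_nonneg hγ.le (mul_nonneg hr0 h0))]
      have : E.ratio σ i * E.loss S z j ≤ 2 * 1 := by gcongr
      nlinarith)
  have hlrn1 : ∑ j, gibbs (E.prior S) (-E.γ) σ.1 j * (E.ratio σ i * E.loss S z j) =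
      E.ratio σ i * E.mixLoss S σ z := by
    rw [mixLoss, Finset.mul_sum]
    refine Finset.sum_congr rfl fun j _ => ?_
    unfold learner
    ring
  have hlrn2 : ∑ j, gibbs (E.prior S) (-E.γ) σ.1 j * (E.ratio σ i * E.loss S z j) ^ 2 ≤ 4 := by
    calc ∑ j, gibbs (E.prior S) (-E.γ) σ.1 j * (E.ratio σ i * E.loss S z j) ^ 2
        ≤ ∑ j, E.learner S σ j * 4 := by
          refine Finset.sum_le_sum fun j _ =>
            mul_le_mul_of_nonneg_left ?_ (E.learner_nonneg S σ j)
          obtain ⟨h0, h1⟩ := E.loss_mem S z j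
          have h2 : E.ratio σ i * E.loss S z j ≤ 2 * 1 := by gcongr
          nlinarith [mul_nonneg hr0 h0]
      _ = 4 := by rw [← Finset.sum_mul, E.sum_learner, one_mul]
  rw [hadv1] at adv
  rw [hlrn1] at lrn
  have adv' : Real.log (∑ k, (1 : Fin n → ℝ) k *
      Real.exp (E.β * (σ.2.1 k + E.gain S σ (i, z) k))) / E.β ≤
      Real.log (∑ k, (1 : Fin n → ℝ) k * Real.exp (E.β * σ.2.1 k)) / E.β +
        E.ratio σ i * E.mixLoss S σ z + 4 * n * E.β := by
    have h : E.β ^ 2 * ∑ k, gibbs 1 E.β σ.2.1 k * E.gain S σ (i, z) k ^ 2 ≤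
      E.β ^ 2 * (4 * n) := by gcongr
    rw [div_add' _ _ _ hβ.ne', div_add' _ _ _ hβ.ne']
    exact div_le_div_of_nonneg_right (by linarith) hβ.le
  have lrn' : Real.log (∑ j, E.prior S j *
      Real.exp (-E.γ * (σ.1 j + E.ratio σ i * E.loss S z j))) / E.γ ≤
      Real.log (∑ j, E.prior S j * Real.exp (-E.γ * σ.1 j)) / E.γ -
        E.ratio σ i * E.mixLoss S σ z + 4 * E.γ := by
    have h : (-E.γ) ^ 2 * ∑ j, gibbs (E.prior S) (-E.γ) σ.1 j *
      (E.ratio σ i * E.loss S z j) ^ 2 ≤ (-E.γ) ^ 2 * 4 := by gcongr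
    rw [div_sub' hγ.ne', div_add' _ _ _ hγ.ne']
    exact div_le_div_of_nonneg_right (by linarith) hγ.le
  simp only [potential, step]
  linarith

/-- The first two terms are the potential of the zero state. The price of the hypothesis class is
thus the logarithm of the total prior mass, not of the size of `J`. -/
theorem potential_state_le (hβ : 0 < E.β) (hβ1 : 2 * n * E.β ≤ 1) (hγ : 0 < E.γ)
    (hγ1 : 2 * E.γ ≤ 1) (S : Transcript X n m₁) (t : ℕ) (τ : Transcript X n (m₁ + t)) :
    E.potential S (E.state S (m₁ + t) τ) ≤ Real.log n / E.β + Real.log (∑ j, E.prior S j) / E.γ +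
      t * (4 * n * E.β + 4 * E.γ) := by
  induction t with
  | zero =>
    have h : E.state S (m₁ + 0) τ = 0 := E.state_of_le S le_rfl τ
    rw [h]
    simp [potential]
  | succ t ih =>
    have h : E.state S (m₁ + (t + 1)) τ = E.step S (E.state S (m₁ + t) (Fin.init τ))
        (τ (Fin.last (m₁ + t))) := by
      change E.state S (m₁ + t + 1) τ = _
      rw [state, if_neg (by omega)]
    rw [h]
    refine (E.potential_step_le hβ hβ1 hγ hγ1 S _ _).trans ?_
    push_cast
    linarith [ih (Fin.init τ)]

/-- The regret bound: no data distribution gains much more than any hypothesis loses. -/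
theorem gain_sub_loss_le (hβ : 0 < E.β) (hβ1 : 2 * n * E.β ≤ 1) (hγ : 0 < E.γ)
    (hγ1 : 2 * E.γ ≤ 1) (S : Transcript X n m₁) (t : ℕ) (τ : Transcript X n (m₁ + t))
    (k : Fin n) (j : J) (hj : 1 ≤ E.prior S j) :
    (E.state S (m₁ + t) τ).2.1 k - (E.state S (m₁ + t) τ).1 j ≤
      Real.log n / E.β + Real.log (∑ j, E.prior S j) / E.γ + t * (4 * n * E.β + 4 * E.γ) := by
  refine le_trans ?_ (E.potential_state_le hβ hβ1 hγ hγ1 S t τ)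
  set σ := E.state S (m₁ + t) τ
  -- The log-partition function dominates each single exponent; for the learner this uses that
  -- hypothesis `j` has prior weight at least 1.
  have h1 : σ.2.1 k ≤
      Real.log (∑ i, (1 : Fin n → ℝ) i * Real.exp (E.β * σ.2.1 i)) / E.β := by
    rw [le_div_iff₀ hβ, mul_comm]
    refine (Real.le_log_iff_exp_le (sum_mul_exp_pos (fun _ => zero_le_one)
      (by simpa using E.n_pos) _ _)).2 ?_
    refine le_trans (by simp) (Finset.single_le_sum
      (f := fun i => (1 : Fin n → ℝ) i * Real.exp (E.β * σ.2.1 i))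
      (fun i _ => mul_nonneg zero_le_one (Real.exp_nonneg _)) (Finset.mem_univ k))
  have h2 : -σ.1 j ≤ Real.log (∑ j, E.prior S j * Real.exp (-E.γ * σ.1 j)) / E.γ := by
    rw [le_div_iff₀ hγ]
    refine (Real.le_log_iff_exp_le (sum_mul_exp_pos (E.prior_nonneg S) (E.prior_pos S) _ _)).2 ?_
    refine le_trans ?_ (Finset.single_le_sum
      (f := fun j => E.prior S j * Real.exp (-E.γ * σ.1 j))
      (fun i _ => mul_nonneg (E.prior_nonneg S i) (Real.exp_nonneg _)) (Finset.mem_univ j))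
    have : -σ.1 j * E.γ = -E.γ * σ.1 j := by ring
    rw [this]
    exact le_mul_of_one_le_left (Real.exp_nonneg _) hj
  unfold potential
  linarith

end Scheme

/-! ### Risks of finite mixtures, and Markov's inequality -/

section Risk

variable {X : Type*} [MeasurableSpace X]

theorem measurable_loss_comp (g : Bool → Bool → ℝ) {h : X → Bool} (hh : Measurable h) :
    Measurable fun z : X × Bool => g (h z.1) z.2 := by
  have hg : Measurable fun p : Bool × Bool => g p.1 p.2 := measurable_of_countable _
  exact hg.comp ((hh.comp measurable_fst).prodMk measurable_snd)

theorem integrable_loss {g : Bool → Bool → ℝ} (hg : ∀ a b, g a b ∈ Set.Icc (0 : ℝ) 1)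
    (D : ProbabilityMeasure (X × Bool)) {h : X → Bool} (hh : Measurable h) :
    Integrable (fun z : X × Bool => g (h z.1) z.2) (D : Measure (X × Bool)) :=
  Integrable.of_bound (measurable_loss_comp g hh).aestronglyMeasurable 1
    (Filter.Eventually.of_forall fun z => by
      rw [Real.norm_of_nonneg (hg _ _).1]
      exact (hg _ _).2)

/-- `φ` need not be injective: a classifier collects the mass of all its indices, and the sum is
regrouped accordingly. -/
theorem randRisk_map {J : Type*} [Fintype J] (g : Bool → Bool → ℝ)
    (D : ProbabilityMeasure (X × Bool)) (p : PMF J) (φ : J → X → Bool) :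
    randRisk g D (p.map φ) = ∑ j, (p j).toReal * risk g D (φ j) := by
  classical
  have h : ∀ f : X → Bool, ((p.map φ) f).toReal * risk g D f =
      ∑ j, if f = φ j then (p j).toReal * risk g D (φ j) else 0 := by
    intro f
    rw [PMF.map_apply, tsum_fintype, ENNReal.toReal_sum, Finset.sum_mul]
    · refine Finset.sum_congr rfl fun j _ => ?_
      split_ifs with hf
      · rw [hf]
      · simp
    · intro j _
      split_ifs
      · exact p.apply_ne_top j
      · exact ENNReal.zero_ne_top
  unfold randRisk
  simp_rw [h]
  rw [Summable.tsum_finsetSum fun j _ =>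
    summable_of_ne_finset_zero (s := {φ j}) fun f hf => if_neg (by simpa using hf)]
  refine Finset.sum_congr rfl fun j _ => ?_
  rw [tsum_eq_single (φ j) fun f hf => if_neg hf, if_pos rfl]

end Risk

theorem measure_ge_le_of_lintegral_le {Ω : Type*} [MeasurableSpace Ω] (μ : Measure Ω)
    {f : Ω → ℝ≥0∞} (hf : Measurable f) {K η : ℝ} (hK : 0 < K) (hη : 0 < η)
    (h : ∫⁻ ω, f ω ∂μ ≤ ENNReal.ofReal K) :
    μ {ω | ENNReal.ofReal (K / η) ≤ f ω} ≤ ENNReal.ofReal η := by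
  have hpos : 0 < K / η := div_pos hK hη
  refine (meas_ge_le_lintegral_div hf.aemeasurable (ENNReal.ofReal_pos.2 hpos).ne'
    ENNReal.ofReal_ne_top).trans ?_
  refine (ENNReal.div_le_div_right h _).trans ?_
  rw [← ENNReal.ofReal_div_of_pos hpos, div_div_cancel₀ hK.ne']

/-! ### Exponential supermartingales -/

namespace Scheme

variable {X : Type*} [MeasurableSpace X] {H : Set (X → Bool)} {n m₁ : ℕ} {J : Type*} [Fintype J]
  (E : Scheme H n m₁ J)

theorem measurable_hyp_apply (S : Transcript X n m₁) (j : J) : Measurable (E.hyp S j) :=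
  (E.measurable_hyp j).comp measurable_prodMk_left

theorem measurable_risk (D : ProbabilityMeasure (X × Bool)) :
    Measurable fun (S : Transcript X n m₁) (j : J) => risk E.g D (E.hyp S j) := by
  refine measurable_pi_lambda _ fun j => ?_
  have h : Measurable fun p : Transcript X n m₁ × (X × Bool) => E.loss p.1 p.2 j :=
    (measurable_pi_apply j).comp E.measurable_loss
  exact h.stronglyMeasurable.integral_prod_right'.measurable

/-- The learner's cumulative risk on the `k`-th data distribution. -/
noncomputable def cumRisk (D : ProbabilityMeasure (X × Bool)) (S : Transcript X n m₁)
    (σ : State n J) : ℝ := ∑ j, σ.2.2 j * risk E.g D (E.hyp S j)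

theorem integral_mixLoss (D : ProbabilityMeasure (X × Bool)) (S : Transcript X n m₁)
    (σ : State n J) : ∫ z, E.mixLoss S σ z ∂(D : Measure (X × Bool)) =
      ∑ j, E.learner S σ j * risk E.g D (E.hyp S j) := by
  unfold mixLoss
  refine (integral_finsetSum (f := fun j z => E.learner S σ j * E.loss S z j) Finset.univ
    fun j _ => (integrable_loss E.g_mem D (E.measurable_hyp_apply S j)).const_mul _).trans ?_
  exact Finset.sum_congr rfl fun j _ => integral_const_mul _ _

theorem measurable_mixLoss_right (S : Transcript X n m₁) (σ : State n J) :
    Measurable (E.mixLoss S σ) :=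
  E.measurable_mixLoss.comp (measurable_prodMk_left (x := (S, σ)))

/-- The gain estimate is unbiased for the learner's risk on `D k`, so the increment of the
difference is centred. Its second moment is of order `1 / mix ≤ 2 * n`, not `n ^ 2`, because the
large value occurs only with probability `mix`. -/
theorem sum_lintegral_exp_cumRisk_le (hβ : 0 < E.β) (hβ1 : 2 * n * E.β ≤ 1)
    (D : Fin n → ProbabilityMeasure (X × Bool)) (k : Fin n) (S : Transcript X n m₁)
    (σ : State n J) :
    ∑ i, ENNReal.ofReal (E.mix σ i) * ∫⁻ z, ENNReal.ofReal (Real.exp (E.β *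
        (E.cumRisk (D k) S (E.step S σ (i, z)) - (E.step S σ (i, z)).2.1 k)))
        ∂(D i : Measure (X × Bool)) ≤
      ENNReal.ofReal (Real.exp (3 * n * E.β ^ 2)) *
        ENNReal.ofReal (Real.exp (E.β * (E.cumRisk (D k) S σ - σ.2.1 k))) := by
  set R := ∫ z, E.mixLoss S σ z ∂(D k : Measure (X × Bool)) with hR
  have hn1 : (1 : ℝ) ≤ n := by exact_mod_cast E.n_pos
  have hmk := E.mix_pos σ k
  have hint : Integrable (E.mixLoss S σ) (D k : Measure (X × Bool)) :=
    Integrable.of_bound (E.measurable_mixLoss_right S σ).aestronglyMeasurable 1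
      (Filter.Eventually.of_forall fun z => by
        rw [Real.norm_of_nonneg (E.mixLoss_mem S σ z).1]
        exact (E.mixLoss_mem S σ z).2)
  have hR0 : 0 ≤ R := integral_nonneg fun z => (E.mixLoss_mem S σ z).1
  have hR1 : R ≤ 1 := by
    calc R ≤ ∫ _, (1 : ℝ) ∂(D k : Measure (X × Bool)) :=
          integral_mono hint (integrable_const 1) fun z => (E.mixLoss_mem S σ z).2
      _ = 1 := by simp
  let f : Fin n → X × Bool → ℝ := fun i z => E.β * (R - E.gain S σ (i, z) k)
  have hgain : ∀ i z, 0 ≤ E.gain S σ (i, z) k ∧ E.gain S σ (i, z) k ≤ 1 / E.mix σ k := by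
    intro i z
    unfold gain
    split_ifs
    · exact ⟨div_nonneg (E.mixLoss_mem S σ z).1 hmk.le,
        div_le_div_of_nonneg_right (E.mixLoss_mem S σ z).2 hmk.le⟩
    · exact ⟨le_rfl, by positivity⟩
  have hsplit : ∀ i z, ENNReal.ofReal (Real.exp (E.β *
      (E.cumRisk (D k) S (E.step S σ (i, z)) - (E.step S σ (i, z)).2.1 k))) =
      ENNReal.ofReal (Real.exp (E.β * (E.cumRisk (D k) S σ - σ.2.1 k))) *
        ENNReal.ofReal (Real.exp (f i z)) := by
    intro i z
    rw [← ENNReal.ofReal_mul (Real.exp_nonneg _), ← Real.exp_add]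
    congr 2
    simp only [f, hR, integral_mixLoss, cumRisk, step, add_mul, Finset.sum_add_distrib]
    ring
  have hfm : ∀ i, Measurable (f i) := by
    intro i
    refine measurable_const.mul (measurable_const.sub ?_)
    by_cases h : i = k
    · simp only [gain, h, if_true]
      exact (E.measurable_mixLoss_right S σ).div_const _
    · simp only [gain, h, if_false]
      exact measurable_const
  have hf1 : ∀ i z, |f i z| ≤ 1 := by
    intro i z
    obtain ⟨h0, h1⟩ := hgain i z
    have h2 := E.inv_mix_le σ k
    have h3 : |R - E.gain S σ (i, z) k| ≤ 2 * n := abs_le.2 ⟨by linarith, by linarith⟩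
    simp only [f, abs_mul, abs_of_pos hβ]
    calc E.β * |R - E.gain S σ (i, z) k| ≤ E.β * (2 * n) := by gcongr
      _ ≤ 1 := by linarith
  have key := sum_lintegral_exp_le (fun i => (D i : Measure (X × Bool)))
    (fun i => (E.mix_pos σ i).le) (E.sum_mix σ) hfm hf1 (c := 3 * n * E.β ^ 2) (by
      calc ∑ i, E.mix σ i * (∫ z, f i z ∂(D i : Measure (X × Bool)) +
            ∫ z, f i z ^ 2 ∂(D i : Measure (X × Bool)))
          -- The terms `β * R` have total weight one and are cancelled by the single correction at
          -- `i = k`.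
          ≤ ∑ i, (E.mix σ i * (E.β * R + E.β ^ 2) +
              if i = k then 2 * n * E.β ^ 2 - E.β * R else 0) := by
            refine Finset.sum_le_sum fun i _ => ?_
            by_cases hik : i = k
            · subst hik
              have hfi : ∀ z, f i z = E.β * R - E.β / E.mix σ i * E.mixLoss S σ z := by
                intro z
                simp only [f, gain, if_true]
                ring
              have h1 : ∫ z, f i z ∂(D i : Measure (X × Bool)) =
                  E.β * R - E.β / E.mix σ i * R := by
                simp_rw [hfi]
                rw [integral_sub (integrable_const _) (hint.const_mul _)]
                simp [integral_const_mul, hR]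
              have h2 : ∫ z, f i z ^ 2 ∂(D i : Measure (X × Bool)) ≤
                  E.β ^ 2 * (1 + (1 / E.mix σ i) ^ 2) := by
                calc ∫ z, f i z ^ 2 ∂(D i : Measure (X × Bool))
                    ≤ ∫ _, E.β ^ 2 * (1 + (1 / E.mix σ i) ^ 2) ∂(D i : Measure (X × Bool)) := by
                      refine integral_mono_of_nonneg
                        (Filter.Eventually.of_forall fun z => sq_nonneg _) (integrable_const _)
                        (Filter.Eventually.of_forall fun z => ?_)
                      obtain ⟨h0, h1⟩ := hgain i z
                      simp only [f, mul_pow]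
                      refine mul_le_mul_of_nonneg_left ?_ (sq_nonneg _)
                      -- The cross term of the square is nonpositive, since both `R` and the gain
                      -- are nonnegative.
                      nlinarith [mul_nonneg hR0 h0]
                  _ = _ := by simp
              have h3 := E.inv_mix_le σ i
              rw [if_pos rfl, h1]
              calc E.mix σ i * (E.β * R - E.β / E.mix σ i * R +
                    ∫ z, f i z ^ 2 ∂(D i : Measure (X × Bool)))
                  ≤ E.mix σ i * (E.β * R - E.β / E.mix σ i * R +
                    E.β ^ 2 * (1 + (1 / E.mix σ i) ^ 2)) := by gcongr
                _ = E.mix σ i * (E.β * R + E.β ^ 2) +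
                    (E.β ^ 2 * (1 / E.mix σ i) - E.β * R) := by
                    field_simp
                    ring
                _ ≤ _ := by nlinarith [sq_nonneg E.β]
            · have hfi : ∀ z, f i z = E.β * R := by
                intro z
                simp [f, gain, hik]
              simp only [hfi, integral_const, probReal_univ, one_smul, if_neg hik, add_zero]
              refine mul_le_mul_of_nonneg_left ?_ (E.mix_pos σ i).le
              have : R ^ 2 ≤ 1 := pow_le_one₀ hR0 hR1
              nlinarith [sq_nonneg E.β]
        _ = E.β ^ 2 + 2 * n * E.β ^ 2 := by
            rw [Finset.sum_add_distrib, ← Finset.sum_mul, E.sum_mix]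
            simp
            ring
        _ ≤ 3 * n * E.β ^ 2 := by nlinarith [sq_nonneg E.β])
  calc _ = ENNReal.ofReal (Real.exp (E.β * (E.cumRisk (D k) S σ - σ.2.1 k))) *
        ∑ i, ENNReal.ofReal (E.mix σ i) *
          ∫⁻ z, ENNReal.ofReal (Real.exp (f i z)) ∂(D i : Measure (X × Bool)) := by
        rw [Finset.mul_sum]
        refine Finset.sum_congr rfl fun i _ => ?_
        simp_rw [hsplit]
        rw [lintegral_const_mul _ (hfm i).exp.ennreal_ofReal]
        ring
    _ ≤ _ := by
        rw [mul_comm]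
        gcongr

/-- Under the sampling law, the mean of the weighted loss is the risk averaged over the adversary's
strategy. This is at most `v` because every single risk is. -/
theorem sum_lintegral_exp_loss_le (hγ : 0 < E.γ) (hγ1 : 2 * E.γ ≤ 1)
    (D : Fin n → ProbabilityMeasure (X × Bool)) (S : Transcript X n m₁) (j : J) {v : ℝ}
    (hv : ∀ k, risk E.g (D k) (E.hyp S j) ≤ v) (σ : State n J) :
    ∑ i, ENNReal.ofReal (E.mix σ i) * ∫⁻ z, ENNReal.ofReal (Real.exp (E.γ *
        (E.step S σ (i, z)).1 j)) ∂(D i : Measure (X × Bool)) ≤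
      ENNReal.ofReal (Real.exp (E.γ * v + 4 * E.γ ^ 2)) *
        ENNReal.ofReal (Real.exp (E.γ * σ.1 j)) := by
  let f : Fin n → X × Bool → ℝ := fun i z => E.γ * E.ratio σ i * E.loss S z j
  have hfm : ∀ i, Measurable (f i) := fun i =>
    (measurable_loss_comp E.g (E.measurable_hyp_apply S j)).const_mul _
  have hbd : ∀ i z, 0 ≤ f i z ∧ f i z ≤ 2 * E.γ := by
    intro i z
    obtain ⟨h0, h1⟩ := E.loss_mem S z j
    have hr0 := E.ratio_nonneg σ i
    have hr2 := E.ratio_le σ i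
    refine ⟨by positivity, ?_⟩
    calc E.γ * E.ratio σ i * E.loss S z j ≤ E.γ * 2 * 1 := by gcongr
      _ = 2 * E.γ := by ring
  have key := sum_lintegral_exp_le (fun i => (D i : Measure (X × Bool)))
    (fun i => (E.mix_pos σ i).le) (E.sum_mix σ) hfm
    (fun i z => by rw [abs_of_nonneg (hbd i z).1]; exact (hbd i z).2.trans hγ1)
    (c := E.γ * v + 4 * E.γ ^ 2) (by
      calc ∑ i, E.mix σ i * (∫ z, f i z ∂(D i : Measure (X × Bool)) +
            ∫ z, f i z ^ 2 ∂(D i : Measure (X × Bool)))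
          ≤ ∑ i, (E.γ * v * E.adversary σ i + E.mix σ i * (4 * E.γ ^ 2)) := by
            refine Finset.sum_le_sum fun i _ => ?_
            have h1 : ∫ z, f i z ∂(D i : Measure (X × Bool)) =
                E.γ * E.ratio σ i * risk E.g (D i) (E.hyp S j) := integral_const_mul _ _
            have h2 : ∫ z, f i z ^ 2 ∂(D i : Measure (X × Bool)) ≤ 4 * E.γ ^ 2 := by
              calc ∫ z, f i z ^ 2 ∂(D i : Measure (X × Bool))
                  ≤ ∫ _, 4 * E.γ ^ 2 ∂(D i : Measure (X × Bool)) := by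
                    refine integral_mono_of_nonneg
                      (Filter.Eventually.of_forall fun z => sq_nonneg _) (integrable_const _)
                      (Filter.Eventually.of_forall fun z => ?_)
                    obtain ⟨h0, h1⟩ := hbd i z
                    change f i z ^ 2 ≤ 4 * E.γ ^ 2
                    nlinarith
                _ = _ := by simp
            rw [h1, mul_add]
            refine add_le_add ?_ (mul_le_mul_of_nonneg_left h2 (E.mix_pos σ i).le)
            calc E.mix σ i * (E.γ * E.ratio σ i * risk E.g (D i) (E.hyp S j))
                = E.γ * (E.mix σ i * E.ratio σ i) * risk E.g (D i) (E.hyp S j) := by ring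
              _ = E.γ * E.adversary σ i * risk E.g (D i) (E.hyp S j) := by rw [E.mix_mul_ratio]
              _ ≤ E.γ * E.adversary σ i * v := by
                  have := E.adversary_nonneg σ i
                  gcongr
                  exact hv i
              _ = _ := by ring
        _ = E.γ * v + 4 * E.γ ^ 2 := by
            rw [Finset.sum_add_distrib, ← Finset.mul_sum, ← Finset.sum_mul, E.sum_mix,
              E.sum_adversary]
            ring
        _ ≤ _ := le_rfl)
  calc _ = ENNReal.ofReal (Real.exp (E.γ * σ.1 j)) *
        ∑ i, ENNReal.ofReal (E.mix σ i) *
          ∫⁻ z, ENNReal.ofReal (Real.exp (f i z)) ∂(D i : Measure (X × Bool)) := by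
        rw [Finset.mul_sum]
        refine Finset.sum_congr rfl fun i _ => ?_
        have hsplit : ∀ z, ENNReal.ofReal (Real.exp (E.γ * (E.step S σ (i, z)).1 j)) =
            ENNReal.ofReal (Real.exp (E.γ * σ.1 j)) * ENNReal.ofReal (Real.exp (f i z)) := by
          intro z
          rw [← ENNReal.ofReal_mul (Real.exp_nonneg _), ← Real.exp_add]
          congr 2
          simp only [f, step]
          ring
        simp_rw [hsplit]
        rw [lintegral_const_mul _ (hfm i).exp.ennreal_ofReal]
        ring
    _ ≤ _ := by
        rw [mul_comm]
        gcongr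

end Scheme

/-! ### High-probability bounds -/

namespace Scheme

variable {X : Type*} [MeasurableSpace X] {H : Set (X → Bool)} {n m₁ : ℕ} {J : Type*} [Fintype J]
  (E : Scheme H n m₁ J)

/-- Later calls do not affect the law of the preliminary sample: the indicator of `B` ignores the
state and grows by the factor 1. -/
theorem law_initial_le (T : ℕ) (hT : 0 < T) (D : Fin n → ProbabilityMeasure (X × Bool))
    {B : Set (Transcript X n m₁)} (hB : MeasurableSet B) :
    (E.algorithm T hT).law D (m₁ + T) {τ | initial (Nat.le_add_right m₁ T) τ ∈ B} ≤
      (E.algorithm T hT).law D m₁ B := by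
  have h := E.lintegral_le_pow_mul T hT D (fun S _ => B.indicator 1 S)
    ((measurable_one.indicator hB).comp measurable_fst) 1 (fun S σ => by
      simp only [lintegral_const, measure_univ, mul_one]
      rw [← Finset.sum_mul, ← ENNReal.ofReal_sum_of_nonneg fun i _ => (E.mix_pos σ i).le,
        E.sum_mix, ENNReal.ofReal_one]) T
  rw [one_pow, one_mul, lintegral_indicator_one hB] at h
  exact (lintegral_indicator_one (measurable_initial (Nat.le_add_right m₁ T) hB)).symm.trans_le h

theorem measurable_cumRisk (D : ProbabilityMeasure (X × Bool)) :
    Measurable fun p : Transcript X n m₁ × State n J => E.cumRisk D p.1 p.2 := by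
  have h : Measurable fun p : Transcript X n m₁ × State n J =>
      fun j => risk E.g D (E.hyp p.1 j) := (E.measurable_risk D).comp measurable_fst
  unfold cumRisk
  exact Finset.measurable_fun_sum _ fun j _ =>
    Measurable.mul (by fun_prop) ((measurable_pi_apply j).comp h)

theorem law_cumRisk_sub_gain_le (hβ : 0 < E.β) (hβ1 : 2 * n * E.β ≤ 1) (T : ℕ) (hT : 0 < T)
    (D : Fin n → ProbabilityMeasure (X × Bool)) (k : Fin n) {η : ℝ} (hη : 0 < η) :
    (E.algorithm T hT).law D (m₁ + T) {τ | T * (3 * n * E.β) + Real.log (1 / η) / E.β ≤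
      E.cumRisk (D k) (initial (Nat.le_add_right m₁ T) τ)
        (E.state (initial (Nat.le_add_right m₁ T) τ) (m₁ + T) τ) -
      (E.state (initial (Nat.le_add_right m₁ T) τ) (m₁ + T) τ).2.1 k} ≤ ENNReal.ofReal η := by
  let Ψ : Transcript X n m₁ → State n J → ℝ≥0∞ := fun S σ =>
    ENNReal.ofReal (Real.exp (E.β * (E.cumRisk (D k) S σ - σ.2.1 k)))
  have hΨ : Measurable fun p : Transcript X n m₁ × State n J => Ψ p.1 p.2 := by
    have := E.measurable_cumRisk (D k)
    fun_prop
  have h := E.lintegral_le_pow_mul T hT D Ψ hΨ _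
    (E.sum_lintegral_exp_cumRisk_le hβ hβ1 D k) T
  have h0 : ∀ S, Ψ S 0 = 1 := fun S => by simp [Ψ, cumRisk]
  simp only [h0, lintegral_const, measure_univ, mul_one] at h
  rw [← ENNReal.ofReal_pow (Real.exp_nonneg _), ← Real.exp_nat_mul] at h
  refine le_trans (measure_mono ?_) (measure_ge_le_of_lintegral_le _
    (hΨ.comp ((measurable_initial _).prodMk (E.measurable_state_initial _)))
    (Real.exp_pos _) hη h)
  intro τ hτ
  refine ENNReal.ofReal_le_ofReal ?_
  have hexp : Real.exp (T * (3 * n * E.β ^ 2)) / η =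
      Real.exp (T * (3 * n * E.β ^ 2) + Real.log (1 / η)) := by
    rw [Real.exp_add, Real.exp_log (by positivity)]
    ring
  rw [hexp, Real.exp_le_exp]
  have h1 : E.β * (T * (3 * n * E.β) + Real.log (1 / η) / E.β) =
      T * (3 * n * E.β ^ 2) + Real.log (1 / η) := by
    field_simp
  rw [← h1]
  exact mul_le_mul_of_nonneg_left hτ hβ.le

theorem law_loss_le [MeasurableSpace J] [MeasurableSingletonClass J] (hγ : 0 < E.γ)
    (hγ1 : 2 * E.γ ≤ 1) (T : ℕ) (hT : 0 < T) (D : Fin n → ProbabilityMeasure (X × Bool))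
    {jstar : Transcript X n m₁ → J} (hj : Measurable jstar) (v : ℝ)
    {G : Set (Transcript X n m₁)} (hG : MeasurableSet G)
    (hv : ∀ S ∈ G, ∀ k, risk E.g (D k) (E.hyp S (jstar S)) ≤ v) {η : ℝ} (hη : 0 < η) :
    (E.algorithm T hT).law D (m₁ + T) {τ | initial (Nat.le_add_right m₁ T) τ ∈ G ∧
      T * (v + 4 * E.γ) + Real.log (1 / η) / E.γ ≤
        (E.state (initial (Nat.le_add_right m₁ T) τ) (m₁ + T) τ).1
          (jstar (initial (Nat.le_add_right m₁ T) τ))} ≤ ENNReal.ofReal η := by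
  classical
  -- The risk bound for the comparator is known only on `G`, so the potential is set to zero
  -- elsewhere.
  let Ψ : Transcript X n m₁ → State n J → ℝ≥0∞ := fun S σ =>
    if S ∈ G then ENNReal.ofReal (Real.exp (E.γ * σ.1 (jstar S))) else 0
  have hΨ : Measurable fun p : Transcript X n m₁ × State n J => Ψ p.1 p.2 := by
    have h1 : Measurable fun p : Transcript X n m₁ × State n J => p.2.1 (jstar p.1) :=
      Measurable.eval_index (by fun_prop) (by fun_prop)
    exact Measurable.ite (measurable_fst hG) (by fun_prop) measurable_const
  have h := E.lintegral_le_pow_mul T hT D Ψ hΨ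
    (ENNReal.ofReal (Real.exp (E.γ * v + 4 * E.γ ^ 2))) (fun S σ => by
      by_cases hS : S ∈ G
      · simpa only [Ψ, hS, if_true] using
          E.sum_lintegral_exp_loss_le hγ hγ1 D S (jstar S) (hv S hS) σ
      · simp [Ψ, hS]) T
  have h0 : ∀ S, Ψ S 0 ≤ 1 := fun S => by
    by_cases hS : S ∈ G <;> simp [Ψ, hS]
  have h' := h.trans (mul_le_of_le_one_right' ((lintegral_mono h0).trans (by simp)))
  rw [← ENNReal.ofReal_pow (Real.exp_nonneg _), ← Real.exp_nat_mul] at h'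
  refine le_trans (measure_mono ?_) (measure_ge_le_of_lintegral_le _
    (hΨ.comp ((measurable_initial _).prodMk (E.measurable_state_initial _)))
    (Real.exp_pos _) hη h')
  rintro τ ⟨hS, hτ⟩
  simp only [Set.mem_ofPred_eq, Function.comp_apply, Ψ, if_pos hS]
  refine ENNReal.ofReal_le_ofReal ?_
  have hexp : Real.exp (T * (E.γ * v + 4 * E.γ ^ 2)) / η =
      Real.exp (T * (E.γ * v + 4 * E.γ ^ 2) + Real.log (1 / η)) := by
    rw [Real.exp_add, Real.exp_log (by positivity)]
    ring
  rw [hexp, Real.exp_le_exp]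
  have h1 : E.γ * (T * (v + 4 * E.γ) + Real.log (1 / η) / E.γ) =
      T * (E.γ * v + 4 * E.γ ^ 2) + Real.log (1 / η) := by
    field_simp
  rw [← h1]
  exact mul_le_mul_of_nonneg_left hτ hγ.le

theorem randRisk_output (T : ℕ) (hT : 0 < T) (D : ProbabilityMeasure (X × Bool))
    (τ : Transcript X n (m₁ + T)) :
    randRisk E.g D (E.output T hT τ) = E.cumRisk D (initial (Nat.le_add_right m₁ T) τ)
      (E.state (initial (Nat.le_add_right m₁ T) τ) (m₁ + T) τ) / T := by
  rw [output, randRisk_map, cumRisk, Finset.sum_div]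
  refine Finset.sum_congr rfl fun j _ => ?_
  rw [average, PMF.ofFintype_apply, ENNReal.toReal_ofReal
    (div_nonneg (E.learnerSum_nonneg _ _ _ _) (Nat.cast_nonneg T))]
  ring

/-- The guarantee of the scheme: if the preliminary calls probably yield a hypothesis with risks
at most `v`, then the output probably has risks not much larger than `v`. -/
theorem guarantee [MeasurableSpace J] [MeasurableSingletonClass J] (hβ : 0 < E.β)
    (hβ1 : 2 * n * E.β ≤ 1) (hγ : 0 < E.γ) (hγ1 : 2 * E.γ ≤ 1) (T : ℕ) (hT : 0 < T)
    (D : Fin n → ProbabilityMeasure (X × Bool)) {jstar : Transcript X n m₁ → J}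
    (hj : Measurable jstar) (hprior : ∀ S, 1 ≤ E.prior S (jstar S)) {N : ℝ}
    (hN : ∀ S, ∑ j, E.prior S j ≤ N) {v r δ : ℝ} (hδ : 0 < δ)
    (hbad : (E.algorithm T hT).law D m₁
      {S | ∀ k, risk E.g (D k) (E.hyp S (jstar S)) ≤ v}ᶜ ≤ ENNReal.ofReal (δ / 2))
    (hr : (Real.log n + Real.log (4 * n / δ)) / E.β + (Real.log N + Real.log (4 / δ)) / E.γ
      ≤ T * r) :
    ENNReal.ofReal (1 - δ) ≤ (E.algorithm T hT).law D (m₁ + T)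
      {τ | ∀ k, randRisk E.g (D k) (E.output T hT τ) ≤ v + r + 7 * n * E.β + 8 * E.γ} := by
  have hn := E.cast_pos
  set μ := (E.algorithm T hT).law D (m₁ + T) with hμ
  set G : Set (Transcript X n m₁) := {S | ∀ k, risk E.g (D k) (E.hyp S (jstar S)) ≤ v} with hG
  have hGm : MeasurableSet G := by
    rw [hG, Set.ofPred_forall]
    exact MeasurableSet.iInter fun k => measurableSet_le
      (Measurable.eval_index (f := fun S j => risk E.g (D k) (E.hyp S j))
        (E.measurable_risk (D k)) hj) measurable_const
  -- The failure probability is split into `δ/2` for a bad preliminary sample, `δ/4` for the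
  -- comparator's loss, and `δ/(4n)` for each of the `n` gain estimates.
  set B₁ := {τ : Transcript X n (m₁ + T) | initial (Nat.le_add_right m₁ T) τ ∈ Gᶜ} with hB₁
  set B₂ := {τ : Transcript X n (m₁ + T) | initial (Nat.le_add_right m₁ T) τ ∈ G ∧
      T * (v + 4 * E.γ) + Real.log (1 / (δ / 4)) / E.γ ≤
        (E.state (initial (Nat.le_add_right m₁ T) τ) (m₁ + T) τ).1
          (jstar (initial (Nat.le_add_right m₁ T) τ))} with hB₂
  set B₃ := fun k : Fin n => {τ : Transcript X n (m₁ + T) |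
      T * (3 * n * E.β) + Real.log (1 / (δ / (4 * n))) / E.β ≤
      E.cumRisk (D k) (initial (Nat.le_add_right m₁ T) τ)
        (E.state (initial (Nat.le_add_right m₁ T) τ) (m₁ + T) τ) -
      (E.state (initial (Nat.le_add_right m₁ T) τ) (m₁ + T) τ).2.1 k} with hB₃
  have m1 : μ B₁ ≤ ENNReal.ofReal (δ / 2) := (E.law_initial_le T hT D hGm.compl).trans hbad
  have m2 : μ B₂ ≤ ENNReal.ofReal (δ / 4) :=
    E.law_loss_le hγ hγ1 T hT D hj v hGm (fun S hS => hS) (by positivity)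
  have m3 : μ (⋃ k, B₃ k) ≤ ENNReal.ofReal (δ / 4) := by
    calc μ (⋃ k, B₃ k) ≤ ∑ k, μ (B₃ k) := measure_iUnion_fintype_le _ _
      _ ≤ ∑ _k : Fin n, ENNReal.ofReal (δ / (4 * n)) := Finset.sum_le_sum fun k _ =>
          E.law_cumRisk_sub_gain_le hβ hβ1 T hT D k (by positivity)
      _ = ENNReal.ofReal (δ / 4) := by
          rw [Finset.sum_const, Finset.card_univ, Fintype.card_fin, nsmul_eq_mul,
            ← ENNReal.ofReal_natCast, ← ENNReal.ofReal_mul (Nat.cast_nonneg n)]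
          congr 1
          field_simp
  set good := {τ | ∀ k, randRisk E.g (D k) (E.output T hT τ) ≤ v + r + 7 * n * E.β + 8 * E.γ}
  -- Off these events, true risk is compared with gain (`3nβ` per round), gain with comparator loss
  -- (`4nβ + 4γ`), and loss with `v` (`4γ`), whence `7nβ + 8γ`.
  have hsub : goodᶜ ⊆ B₁ ∪ B₂ ∪ ⋃ k, B₃ k := by
    intro τ hτ
    by_contra hnot
    simp only [Set.mem_union, Set.mem_iUnion, not_or, not_exists] at hnot
    obtain ⟨⟨h1, h2⟩, h3⟩ := hnot
    refine hτ fun k => ?_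
    have hS : initial (Nat.le_add_right m₁ T) τ ∈ G := by
      by_contra h
      exact h1 h
    have h2' := not_le.1 fun h => h2 ⟨hS, h⟩
    have h3' := h3 k
    simp only [hB₃, Set.mem_ofPred_eq, not_le] at h3'
    have h4 := E.gain_sub_loss_le hβ hβ1 hγ hγ1 (initial (Nat.le_add_right m₁ T) τ) T τ k
      (jstar (initial (Nat.le_add_right m₁ T) τ)) (hprior _)
    have h5 : Real.log (∑ j, E.prior (initial (Nat.le_add_right m₁ T) τ) j) / E.γ ≤
        Real.log N / E.γ :=
      div_le_div_of_nonneg_right (Real.log_le_log (E.prior_pos _) (hN _)) hγ.le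
    have e1 : 1 / (δ / 4) = 4 / δ := one_div_div _ _
    have e2 : 1 / (δ / (4 * n)) = 4 * n / δ := one_div_div _ _
    rw [e1] at h2'
    rw [e2] at h3'
    rw [add_div, add_div] at hr
    rw [E.randRisk_output, div_le_iff₀ (Nat.cast_pos.2 hT)]
    linarith
  have hcompl : μ goodᶜ ≤ ENNReal.ofReal δ := by
    calc μ goodᶜ ≤ μ (B₁ ∪ B₂ ∪ ⋃ k, B₃ k) := measure_mono hsub
      _ ≤ μ B₁ + μ B₂ + μ (⋃ k, B₃ k) :=
          (measure_union_le _ _).trans (add_le_add_left (measure_union_le _ _) _)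
      _ ≤ ENNReal.ofReal (δ / 2) + ENNReal.ofReal (δ / 4) + ENNReal.ofReal (δ / 4) := by gcongr
      _ = ENNReal.ofReal δ := by
          rw [← ENNReal.ofReal_add (by positivity) (by positivity),
            ← ENNReal.ofReal_add (by positivity) (by positivity)]
          congr 1
          ring
  rw [ENNReal.ofReal_sub _ hδ.le, ENNReal.ofReal_one, tsub_le_iff_right]
  calc (1 : ℝ≥0∞) = μ (good ∪ goodᶜ) := by rw [Set.union_compl_self, measure_univ]
    _ ≤ μ good + μ goodᶜ := measure_union_le _ _
    _ ≤ μ good + ENNReal.ofReal δ := by gcongr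

end Scheme

/-! ### Logarithmic estimates -/

/-- The tangent line of the logarithm at `b`. A suitable `b` solves implicit inequalities in which a
quantity is bounded by its own logarithm. -/
theorem log_le_div_add_log {a b : ℝ} (ha : 0 < a) (hb : 0 < b) :
    Real.log a ≤ a / b + Real.log b := by
  have h := Real.log_le_sub_one_of_pos (div_pos ha hb)
  rw [Real.log_div ha.ne' hb.ne'] at h
  linarith

theorem one_le_log_four : 1 ≤ Real.log 4 := by
  have h : Real.log 4 = 2 * Real.log 2 := by
    rw [show (4 : ℝ) = 2 ^ 2 by norm_num, Real.log_pow]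
    norm_num
  linarith [Real.log_two_gt_d9]

theorem log_four_le_two : Real.log 4 ≤ 2 := by
  have h : Real.log 4 = 2 * Real.log 2 := by
    rw [show (4 : ℝ) = 2 ^ 2 by norm_num, Real.log_pow]
    norm_num
  linarith [Real.log_two_lt_d9]

/-- A class of VC dimension `d ≥ 1` has a finite cover of size `(4 d / θ) ^ (4 d)`. -/
theorem exists_cover_log_card_le {X : Type*} [MeasurableSpace X] {H : Set (X → Bool)} {d : ℕ}
    (hd : vcDim H = d) (hd1 : 1 ≤ d) (hne : H.Nonempty) (hm : ∀ h ∈ H, Measurable h)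
    (P : Measure X) [IsProbabilityMeasure P] {θ : ℝ} (hθ : 0 < θ) (hθ1 : θ ≤ 1) :
    ∃ F : Finset (X → Bool), ↑F ⊆ H ∧ F.Nonempty ∧
      Real.log F.card ≤ 4 * d * Real.log (4 * d / θ) ∧
      ∀ h ∈ H, ∃ h' ∈ F, P.real {x | h x ≠ h' x} ≤ θ := by
  have hd' : (1 : ℝ) ≤ d := by exact_mod_cast hd1
  have hlog : 1 ≤ Real.log (4 * d / θ) := by
    refine one_le_log_four.trans (Real.log_le_log (by norm_num) ?_)
    rw [le_div_iff₀ hθ]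
    nlinarith
  have hN : ∀ F : Finset (X → Bool), ↑F ⊆ H →
      (∀ h ∈ F, ∀ h' ∈ F, h ≠ h' → θ < P.real {x | h x ≠ h' x}) →
      F.card ≤ ⌊Real.exp (4 * d * Real.log (4 * d / θ))⌋₊ := by
    intro F hF hsep
    rcases Nat.eq_zero_or_pos F.card with h0 | hpos
    · rw [h0]
      exact Nat.zero_le _
    have hMpos : (0 : ℝ) < F.card := Nat.cast_pos.2 hpos
    have hM1 : (1 : ℝ) ≤ F.card := by exact_mod_cast hpos
    set lM := Real.log F.card with hlM
    have hlM0 : 0 ≤ lM := Real.log_nonneg hM1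
    -- Enough points for `(1 - θ) ^ m` to beat the at most `F.card ^ 2` pairs: the product is at
    -- most `exp (-1)`.
    set m := ⌈(2 * lM + 1) / θ⌉₊ with hmdef
    have hm1 : (2 * lM + 1) / θ ≤ m := Nat.le_ceil _
    have hm2 : (m : ℝ) < (2 * lM + 1) / θ + 1 := Nat.ceil_lt_add_one (by positivity)
    have hsmall : (F.card : ℝ) ^ 2 * (1 - θ) ^ m < 1 := by
      have h1 : (1 - θ) ^ m ≤ Real.exp (-(2 * lM + 1)) := by
        calc (1 - θ) ^ m ≤ Real.exp (-θ) ^ m :=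
              pow_le_pow_left₀ (by linarith) (by linarith [Real.add_one_le_exp (-θ)]) m
          _ = Real.exp (m * -θ) := (Real.exp_nat_mul _ _).symm
          _ ≤ Real.exp (-(2 * lM + 1)) := by
              rw [Real.exp_le_exp]
              rw [div_le_iff₀ hθ] at hm1
              linarith
      have h2 : (F.card : ℝ) ^ 2 = Real.exp (2 * lM) := by
        rw [two_mul, Real.exp_add, hlM, Real.exp_log hMpos, sq]
      calc (F.card : ℝ) ^ 2 * (1 - θ) ^ m ≤ Real.exp (2 * lM) * Real.exp (-(2 * lM + 1)) := by
            rw [h2]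
            gcongr
        _ = Real.exp (-1) := by
            rw [← Real.exp_add]
            congr 1
            ring
        _ < 1 := by
            rw [← Real.exp_zero, Real.exp_lt_exp]
            norm_num
    have hcard := card_le_of_separated hd hm P F hF hsep m hsmall
    have hlog1 : lM ≤ d * Real.log (m + 1) := by
      rw [hlM, ← Real.log_pow]
      exact Real.log_le_log hMpos (by exact_mod_cast hcard)
    -- With `m` of order `2 * lM / θ`, this tangent point leaves only `lM / 2` on the right, which
    -- the left-hand side absorbs.
    have hlog2 : Real.log (m + 1) ≤ (m + 1) / (4 * d / θ) + Real.log (4 * d / θ) :=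
      log_le_div_add_log (by positivity) (by positivity)
    have hm3 : (m + 1 : ℝ) ≤ (2 * lM + 3) / θ := by
      have : (2 : ℝ) ≤ 2 / θ := by
        rw [le_div_iff₀ hθ]
        linarith
      calc (m + 1 : ℝ) ≤ (2 * lM + 1) / θ + 2 := by linarith
        _ ≤ (2 * lM + 1) / θ + 2 / θ := by linarith
        _ = (2 * lM + 3) / θ := by ring
    have hm4 : (m + 1 : ℝ) / (4 * d / θ) ≤ (2 * lM + 3) / (4 * d) := by
      calc (m + 1 : ℝ) / (4 * d / θ) ≤ (2 * lM + 3) / θ / (4 * d / θ) := by gcongr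
        _ = (2 * lM + 3) / (4 * d) := by field_simp
    have hfin : lM ≤ (2 * lM + 3) / 4 + d * Real.log (4 * d / θ) := by
      calc lM ≤ d * ((2 * lM + 3) / (4 * d) + Real.log (4 * d / θ)) :=
            hlog1.trans (mul_le_mul_of_nonneg_left (by linarith) (by positivity))
        _ = _ := by field_simp
    refine Nat.le_floor ?_
    rw [← Real.exp_log hMpos, Real.exp_le_exp, ← hlM]
    nlinarith
  obtain ⟨F, hFH, hcard, hcov⟩ := exists_cover P hθ.le hN
  obtain ⟨h, hh⟩ := hne
  obtain ⟨h', hh', -⟩ := hcov h hh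
  have hFne : F.Nonempty := ⟨h', hh'⟩
  refine ⟨F, hFH, hFne, ?_, hcov⟩
  rw [Real.log_le_iff_le_exp (Nat.cast_pos.2 hFne.card_pos)]
  exact (Nat.cast_le.2 hcard).trans (Nat.floor_le (Real.exp_nonneg _))

/-! ### Lower bounds for the rate -/

section Rate

variable {d n : ℕ} {ε δ : ℝ}

theorem one_le_rate : 1 ≤ rate d n ε δ := le_max_left _ _

theorem log_dim_nonneg (hd : 1 ≤ d) (hn : 1 ≤ n) (hε : ε ∈ Set.Ioo (0 : ℝ) 1) :
    0 ≤ Real.log (d * n / ε) := by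
  refine Real.log_nonneg ?_
  rw [le_div_iff₀ hε.1]
  have : (1 : ℝ) ≤ d * n := by exact_mod_cast Nat.mul_pos hd hn
  linarith [hε.2]

theorem log_conf_nonneg (hn : 1 ≤ n) (hδ : δ ∈ Set.Ioo (0 : ℝ) 1) : 0 ≤ Real.log (n / δ) := by
  refine Real.log_nonneg ?_
  rw [le_div_iff₀ hδ.1]
  have : (1 : ℝ) ≤ n := by exact_mod_cast hn
  linarith [hδ.2]

theorem dim_div_le_rate (hn : 1 ≤ n)
    (hδ : δ ∈ Set.Ioo (0 : ℝ) 1) : d * Real.log (d * n / ε) / ε ^ 2 ≤ rate d n ε δ := by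
  refine le_trans (div_le_div_of_nonneg_right ?_ (sq_nonneg ε)) (le_max_right _ _)
  have := mul_nonneg (Nat.cast_nonneg (α := ℝ) n) (log_conf_nonneg hn hδ)
  linarith

theorem conf_div_le_rate (hd : 1 ≤ d) (hn : 1 ≤ n) (hε : ε ∈ Set.Ioo (0 : ℝ) 1) :
    n * Real.log (n / δ) / ε ^ 2 ≤ rate d n ε δ := by
  refine le_trans (div_le_div_of_nonneg_right ?_ (sq_nonneg ε)) (le_max_right _ _)
  have := mul_nonneg (Nat.cast_nonneg (α := ℝ) d) (log_dim_nonneg hd hn hε)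
  linarith

/-- The rate dominates the number of parameters over `ε ^ 2`. -/
theorem add_div_le_rate (hd : 1 ≤ d) (hn : 1 ≤ n) (hε : ε ∈ Set.Ioo (0 : ℝ) 1)
    (hδ : δ ∈ Set.Ioo (0 : ℝ) 1) : ((n : ℝ) + d) / ε ^ 2 ≤ 11 * rate d n ε δ := by
  have hε2 : 0 < ε ^ 2 := pow_pos hε.1 2
  have hd' : (1 : ℝ) ≤ d := by exact_mod_cast hd
  have hn' : (1 : ℝ) ≤ n := by exact_mod_cast hn
  have hl2 := Real.log_two_gt_d9
  have hA := log_dim_nonneg hd hn hε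
  have hB := log_conf_nonneg hn hδ
  have hbig : (2 : ℝ) ≤ d * n / ε → Real.log 2 ≤ Real.log (d * n / ε) := fun h =>
    Real.log_le_log (by norm_num) h
  have key : (n : ℝ) + d ≤ 3 * (d * Real.log (d * n / ε) + n * Real.log (n / δ)) + 8 * ε ^ 2 := by
    -- For `n ≥ 2` both logarithms are at least `log 2`. For `n = 1` they can be tiny, but if `d / ε
    -- < 2` then `d = 1` and `ε > 1/2`, and the term `8 * ε ^ 2`, paid by the maximum with 1,
    -- suffices.
    rcases Nat.lt_or_ge n 2 with h1 | h2
    · have hn1 : (n : ℝ) = 1 := by exact_mod_cast (show n = 1 by omega)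
      by_cases hs : (2 : ℝ) ≤ d * n / ε
      · have := hbig hs
        nlinarith
      · rw [not_le, div_lt_iff₀ hε.1, hn1] at hs
        have hd2 : (d : ℝ) < 2 := by nlinarith [hε.2]
        have hd1 : (d : ℝ) = 1 := by
          have : d < 2 := by exact_mod_cast hd2
          exact_mod_cast (show d = 1 by omega)
        have : 0 ≤ d * Real.log (d * n / ε) + n * Real.log (n / δ) := by positivity
        rw [hd1] at hs
        nlinarith [hε.1]
    · have hn2 : (2 : ℝ) ≤ n := by exact_mod_cast h2
      have h3 : Real.log 2 ≤ Real.log (d * n / ε) := hbig (by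
        rw [le_div_iff₀ hε.1]
        nlinarith [hε.2])
      have h4 : Real.log 2 ≤ Real.log (n / δ) := Real.log_le_log (by norm_num) (by
        rw [le_div_iff₀ hδ.1]
        nlinarith [hδ.2])
      nlinarith [hε.1]
  calc ((n : ℝ) + d) / ε ^ 2
      ≤ (3 * (d * Real.log (d * n / ε) + n * Real.log (n / δ)) + 8 * ε ^ 2) / ε ^ 2 := by gcongr
    _ = 3 * ((d * Real.log (d * n / ε) + n * Real.log (n / δ)) / ε ^ 2) + 8 := by
        rw [add_div, mul_div_assoc, mul_div_cancel_right₀ _ hε2.ne']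
    _ ≤ 3 * rate d n ε δ + 8 * rate d n ε δ := by
        have h1 : (d * Real.log (d * n / ε) + n * Real.log (n / δ)) / ε ^ 2 ≤ rate d n ε δ :=
          le_max_right _ _
        linarith [one_le_rate (d := d) (n := n) (ε := ε) (δ := δ)]
    _ = 11 * rate d n ε δ := by ring

end Rate

/-! ### Comparing risks -/

section Compare

variable {X : Type*} [MeasurableSpace X]

theorem exists_risk_le {n d : ℕ} {H : Set (X → Bool)} {g : Bool → Bool → ℝ} {ε δ : ℝ}
    (hp : IsProblem H d n g ε δ) (D : Fin n → ProbabilityMeasure (X × Bool)) {η : ℝ}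
    (hη : 0 < η) : ∃ h ∈ H, ∀ i, risk g (D i) h ≤ opt H g D + η := by
  have : Nonempty H := hp.nonempty.to_subtype
  obtain ⟨h, hh⟩ := exists_lt_of_ciInf_lt
    (show ⨅ h : H, ⨆ i, risk g (D i) h.1 < opt H g D + η from lt_add_of_pos_right _ hη)
  exact ⟨h.1, h.2, fun i => (le_ciSup (f := fun i => risk g (D i) h.1)
    (Set.finite_range _).bddAbove i).trans hh.le⟩

theorem risk_le_add {g : Bool → Bool → ℝ} (hg : ∀ a b, g a b ∈ Set.Icc (0 : ℝ) 1)
    (D : ProbabilityMeasure (X × Bool)) {h h' : X → Bool} (hh : Measurable h)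
    (hh' : Measurable h') :
    risk g D h' ≤ risk g D h + (D : Measure (X × Bool)).real {z | h z.1 ≠ h' z.1} := by
  have hm : MeasurableSet {z : X × Bool | h z.1 ≠ h' z.1} :=
    (measurableSet_eq_fun (hh.comp measurable_fst) (hh'.comp measurable_fst)).compl
  rw [← integral_indicator_one hm]
  have hi : Integrable ({z : X × Bool | h z.1 ≠ h' z.1}.indicator (1 : X × Bool → ℝ))
      (D : Measure (X × Bool)) := (integrable_const (1 : ℝ)).indicator hm
  unfold risk
  rw [← integral_add (integrable_loss hg D hh) hi]
  refine integral_mono (integrable_loss hg D hh') ((integrable_loss hg D hh).add hi) fun z => ?_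
  by_cases hz : h z.1 = h' z.1
  · simp [hz]
  · rw [Set.indicator_of_mem (show z ∈ {z : X × Bool | h z.1 ≠ h' z.1} from hz)]
    have h1 := (hg (h' z.1) z.2).2
    have h2 := (hg (h z.1) z.2).1
    simp only [Pi.one_apply]
    linarith

end Compare

/-! ### From schemes to sample complexity -/

section Solve

variable {X : Type*} [MeasurableSpace X] {H : Set (X → Bool)} {d n : ℕ} {g : Bool → Bool → ℝ}
  {ε δ : ℝ}

/-- The excess risk splits into `ε/4` for the comparator, `ε/4` for the logarithmic terms, and `7nβ
+ 8γ = 15ε/40`, which add up to less than `ε`. -/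
theorem solvableWithin_of_scheme (hp : IsProblem H d n g ε δ) {m₁ : ℕ} {J : Type*} [Fintype J]
    [MeasurableSpace J] [MeasurableSingletonClass J] (E : Scheme H n m₁ J) (hg : E.g = g)
    (hβ : E.β = ε / (40 * n)) (hγ : E.γ = ε / 40) {L : ℝ} (hL0 : 0 ≤ L)
    (hL : ∀ S, Real.log (∑ j, E.prior S j) ≤ L)
    (𝔇 : Set (Fin n → ProbabilityMeasure (X × Bool)))
    (hpre : ∀ D ∈ 𝔇, ∃ jstar : Transcript X n m₁ → J, Measurable jstar ∧
      (∀ S, 1 ≤ E.prior S (jstar S)) ∧ ∀ T hT, (E.algorithm T hT).law D m₁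
        {S | ∀ k, risk g (D k) (E.hyp S (jstar S)) ≤ opt H g D + ε / 4}ᶜ ≤
          ENNReal.ofReal (δ / 2)) {N : ℝ}
    (hN : m₁ + (160 * ((3 * n * Real.log (n / δ) + 4 * n + L) / ε ^ 2) + 1) ≤ N) :
    SolvableWithin H g ε δ N 𝔇 := by
  subst hg
  have hε := hp.eps_mem
  have hδ := hp.delta_mem
  have hε2 : 0 < ε ^ 2 := pow_pos hε.1 2
  have hn : (1 : ℝ) ≤ n := by exact_mod_cast hp.n_pos
  have hℓ := log_conf_nonneg hp.n_pos hδ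
  -- The inverse learning rates contribute `40 / ε`, and dividing by the allowance `ε / 4` per round
  -- gives `160 / ε ^ 2`.
  set A := 160 * ((3 * n * Real.log (n / δ) + 4 * n + L) / ε ^ 2) with hA
  have hApos : 0 < A := by positivity
  set T := ⌈A⌉₊ with hTdef
  have hT : 0 < T := Nat.ceil_pos.2 hApos
  refine ⟨m₁ + T, ?_, E.algorithm T hT, fun D hD => ?_⟩
  · have := (Nat.ceil_lt_add_one hApos.le).le
    push_cast
    linarith
  obtain ⟨jstar, hj, hprior, hbad⟩ := hpre D hD
  have hsum : ∀ S, ∑ j, E.prior S j ≤ Real.exp L := fun S => by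
    rw [← Real.log_le_iff_le_exp (E.prior_pos S)]
    exact hL S
  have hn0 : (0 : ℝ) < n := by linarith
  have hδ0 := hδ.1
  have hε0 := hε.1
  have hlogδ : Real.log (n / δ) = Real.log n - Real.log δ := Real.log_div hn0.ne' hδ0.ne'
  have hlogn : 0 ≤ Real.log n := Real.log_nonneg hn
  have hlogδ' : Real.log δ ≤ 0 := Real.log_nonpos hδ0.le hδ.2.le
  have e1 : Real.log (4 * n / δ) = Real.log 4 + Real.log (n / δ) := by
    rw [mul_div_assoc, Real.log_mul (by norm_num) (by positivity)]
  have e2 : Real.log (4 / δ) = Real.log 4 - Real.log δ :=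
    Real.log_div (by norm_num) hδ0.ne'
  have hr : (Real.log n + Real.log (4 * n / δ)) / E.β +
      (Real.log (Real.exp L) + Real.log (4 / δ)) / E.γ ≤ T * (ε / 4) := by
    rw [Real.log_exp, hβ, hγ]
    have hAT : A ≤ T := Nat.le_ceil _
    have h4 := log_four_le_two
    calc (Real.log n + Real.log (4 * n / δ)) / (ε / (40 * n)) +
          (L + Real.log (4 / δ)) / (ε / 40)
        = 40 / ε * (n * (Real.log n + Real.log (4 * n / δ)) + (L + Real.log (4 / δ))) := by
          field_simp
      _ ≤ 40 / ε * (3 * n * Real.log (n / δ) + 4 * n + L) := by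
          refine mul_le_mul_of_nonneg_left ?_ (by positivity)
          have h1 : Real.log n + Real.log (4 * n / δ) ≤ 2 * Real.log (n / δ) + 2 := by linarith
          have h2 : Real.log (4 / δ) ≤ Real.log (n / δ) + 2 := by linarith
          nlinarith
      _ = A * (ε / 4) := by
          rw [hA]
          field_simp
          ring
      _ ≤ T * (ε / 4) := by gcongr
  have h7 : E.β * n = ε / 40 := by
    rw [hβ]
    field_simp
  have main := E.guarantee (by rw [hβ]; positivity) (by nlinarith [hε.2])
    (by rw [hγ]; positivity) (by rw [hγ]; linarith [hε.2]) T hT D hj hprior hsum hδ.1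
    (hbad T hT) hr
  refine main.trans (measure_mono fun τ hτ => ⟨(E.algorithm T hT).output_support τ, ?_⟩)
  have : Nonempty (Fin n) := ⟨⟨0, hp.n_pos⟩⟩
  refine ciSup_le fun k => (hτ k).trans ?_
  rw [hγ]
  nlinarith

/-- A class of VC dimension zero has at most one element, and needs no calls. -/
theorem solvableWithin_of_dim_zero (hp : IsProblem H 0 n g ε δ) {N : ℝ} (hN : 0 ≤ N)
    (𝔇 : Set (Fin n → ProbabilityMeasure (X × Bool))) : SolvableWithin H g ε δ N 𝔇 := by
  classical
  obtain ⟨h, hh⟩ := hp.nonempty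
  have huniq : ∀ h' ∈ H, h' = h := by
    intro h' hh'
    by_contra hne
    obtain ⟨x, hx⟩ := Function.ne_iff.1 hne
    have hs : Shatters H {x} := by
      intro b
      by_cases hb : h x = b x
      · exact ⟨h, hh, by simpa using hb⟩
      · refine ⟨h', hh', ?_⟩
        simp only [Finset.mem_singleton, forall_eq]
        revert hx hb
        cases h x <;> cases h' x <;> cases b x <;> simp
    simpa using hs.card_le hp.vcDim_eq
  let A : Algorithm H n 0 :=
    { query := fun _ => Kernel.const _ (Measure.dirac ⟨0, hp.n_pos⟩)
      isMarkov := fun _ => inferInstance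
      output := fun _ => PMF.pure h
      output_support := fun _ => by simpa using hh
      measurable_output := by
        simp only [PMF.pure_map, PMF.pure_apply]
        exact Measurable.ite (measurableSet_eq_fun measurable_const
          ((hp.measurable h hh).comp measurable_snd)) measurable_const measurable_const }
  refine ⟨0, by simpa using hN, A, fun D _ => ?_⟩
  have hall : {τ | IsEpsOptimal H g D ε (A.output τ)} = Set.univ := by
    refine Set.eq_univ_of_forall fun τ => ⟨A.output_support τ, ?_⟩
    have : Nonempty (Fin n) := ⟨⟨0, hp.n_pos⟩⟩
    obtain ⟨h', hh', hr⟩ := exists_risk_le hp D hp.eps_mem.1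
    refine ciSup_le fun i => ?_
    have hpure : randRisk g (D i) (PMF.pure h) = risk g (D i) h := by
      unfold randRisk
      rw [tsum_eq_single h fun f hf => by simp [PMF.pure_apply, hf]]
      simp
    change randRisk g (D i) (PMF.pure h) ≤ _
    rw [hpure, ← huniq h' hh']
    exact hr i
  rw [hall, measure_univ]
  exact ENNReal.ofReal_le_one.2 (by linarith [hp.delta_mem.1])

end Solve

/-! ### Known dominating marginals -/

/-- Applied with `y = d * n / ε`, it makes the logarithm of the domination factor at most a constant
plus a multiple of `log (d * n / ε)`. -/
theorem exists_eval_le_mul_pow (p : MvPolynomial (Fin 3) ℝ) : ∃ (A : ℝ) (k : ℕ), 1 ≤ A ∧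
    ∀ (x : Fin 3 → ℝ) (y : ℝ), 1 ≤ y → (∀ i, 0 ≤ x i) → (∀ i, x i ≤ y) →
      MvPolynomial.eval x p ≤ A * y ^ k := by
  refine ⟨1 + ∑ m ∈ p.support, |p.coeff m|, p.totalDegree,
    le_add_of_nonneg_right (Finset.sum_nonneg fun _ _ => abs_nonneg _), fun x y hy h0 h1 => ?_⟩
  rw [MvPolynomial.eval_eq']
  calc ∑ m ∈ p.support, p.coeff m * ∏ i, x i ^ m i
      ≤ ∑ m ∈ p.support, |p.coeff m| * y ^ p.totalDegree := by
        refine Finset.sum_le_sum fun m hm => ?_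
        have hprod : ∏ i, x i ^ m i ≤ y ^ p.totalDegree := by
          calc ∏ i, x i ^ m i ≤ ∏ i, y ^ m i :=
                Finset.prod_le_prod (fun i _ => pow_nonneg (h0 i) _)
                  fun i _ => pow_le_pow_left₀ (h0 i) (h1 i) _
            _ = y ^ ∑ i, m i := Finset.prod_pow_eq_pow_sum _ _ _
            _ ≤ y ^ p.totalDegree := by
                refine pow_le_pow_right₀ hy ?_
                have h := MvPolynomial.le_totalDegree hm
                rwa [Finsupp.sum_fintype _ _ fun _ => rfl] at h
        calc p.coeff m * ∏ i, x i ^ m i ≤ |p.coeff m| * ∏ i, x i ^ m i :=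
              mul_le_mul_of_nonneg_right (le_abs_self _)
                (Finset.prod_nonneg fun i _ => pow_nonneg (h0 i) _)
          _ ≤ _ := mul_le_mul_of_nonneg_left hprod (abs_nonneg _)
    _ = (∑ m ∈ p.support, |p.coeff m|) * y ^ p.totalDegree := (Finset.sum_mul _ _ _).symm
    _ ≤ _ := mul_le_mul_of_nonneg_right (by linarith) (pow_nonneg (by linarith) _)

section Uniform

variable {n : ℕ}

/-- The uniform mixture of finitely many measures. -/
noncomputable def uniformMixture {Y : Type*} [MeasurableSpace Y] (μ : Fin n → Measure Y) :
    Measure Y := ∑ i, ENNReal.ofReal (1 / n) • μ i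

theorem isProbabilityMeasure_uniformMixture {Y : Type*} [MeasurableSpace Y] (hn : 0 < n)
    (μ : Fin n → Measure Y) [∀ i, IsProbabilityMeasure (μ i)] :
    IsProbabilityMeasure (uniformMixture μ) := by
  refine ⟨?_⟩
  have hn' : (n : ℝ) ≠ 0 := Nat.cast_ne_zero.2 hn.ne'
  simp only [uniformMixture, Measure.finsetSum_apply, Measure.smul_apply, measure_univ,
    smul_eq_mul, mul_one, Finset.sum_const, Finset.card_univ, Fintype.card_fin, nsmul_eq_mul]
  rw [← ENNReal.ofReal_natCast, ← ENNReal.ofReal_mul (Nat.cast_nonneg n), mul_one_div_cancel hn',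
    ENNReal.ofReal_one]

theorem real_le_mul_uniformMixture {Y : Type*} [MeasurableSpace Y] (hn : 0 < n)
    (μ : Fin n → Measure Y) [∀ i, IsProbabilityMeasure (μ i)] (i : Fin n) (s : Set Y) :
    (μ i).real s ≤ n * (uniformMixture μ).real s := by
  have := isProbabilityMeasure_uniformMixture hn μ
  have hn' : (0 : ℝ) < n := Nat.cast_pos.2 hn
  have h : ENNReal.ofReal (1 / n) * μ i s ≤ uniformMixture μ s := by
    simp only [uniformMixture, Measure.finsetSum_apply, Measure.smul_apply, smul_eq_mul]
    exact Finset.single_le_sum (f := fun i => ENNReal.ofReal (1 / n) * μ i s)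
      (fun _ _ => zero_le) (Finset.mem_univ i)
  have h2 := ENNReal.toReal_mono (measure_ne_top _ _) h
  rw [ENNReal.toReal_mul, ENNReal.toReal_ofReal (by positivity), ← measureReal_def,
    ← measureReal_def, one_div, inv_mul_le_iff₀ hn'] at h2
  exact h2

end Uniform

section Dominated

variable {X : Type*} [MeasurableSpace X] {H : Set (X → Bool)} {d n : ℕ} {g : Bool → Bool → ℝ}
  {ε δ : ℝ}

/-- The scheme that plays on a fixed finite set of hypotheses. -/
noncomputable def coverScheme (hp : IsProblem H d n g ε δ) (F : Finset (X → Bool))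
    (hF : ↑F ⊆ H) (hne : F.Nonempty) : Scheme H n 0 F where
  hyp _ j := j.1
  prior _ _ := 1
  mem _ j := hF j.2
  measurable_hyp j := (hp.measurable _ (hF j.2)).comp measurable_snd
  measurable_prior := measurable_const
  prior_nonneg _ _ := zero_le_one
  prior_pos _ := by simpa using hne
  g := g
  g_mem := hp.loss_mem
  n_pos := hp.n_pos
  β := ε / (40 * n)
  γ := ε / 40

/-- One cover under the uniform mixture of the `P i` serves all admissible tuples: passing to `P k`
costs a factor `n` and passing to `D k` a factor `K'`, so scale `ε / (8 * n * K')` yields `ε / 8`.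
`K'` replaces `K`, which may be small or negative, to keep the scale at most 1. -/
theorem solvableWithin_dominatedBy (hp : IsProblem H d n g ε δ) (hd : 1 ≤ d) {K K' : ℝ}
    (hKK : K ≤ K') (hK' : 1 ≤ K') (P : Fin n → ProbabilityMeasure X) {N : ℝ}
    (hN : 160 * ((3 * n * Real.log (n / δ) + 4 * n +
      4 * d * Real.log (4 * d / (ε / (8 * n * K')))) / ε ^ 2) + 1 ≤ N) :
    SolvableWithin H g ε δ N (dominatedBy K P) := by
  have hn1 : (1 : ℝ) ≤ n := by exact_mod_cast hp.n_pos
  have hd1 : (1 : ℝ) ≤ d := by exact_mod_cast hd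
  have hε := hp.eps_mem
  have hε0 := hε.1
  have hθ : 0 < ε / (8 * n * K') := by positivity
  have hθ1 : ε / (8 * n * K') ≤ 1 := by
    rw [div_le_one (by positivity)]
    have : 1 * 1 ≤ (n : ℝ) * K' := mul_le_mul hn1 hK' zero_le_one (by linarith)
    linarith [hε.2]
  have := isProbabilityMeasure_uniformMixture hp.n_pos fun i => (P i : Measure X)
  obtain ⟨F, hF, hne, hcard, hcov⟩ := exists_cover_log_card_le hp.vcDim_eq hd hp.nonempty
    hp.measurable (uniformMixture fun i => (P i : Measure X)) hθ hθ1
  let _ : MeasurableSpace F := ⊤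
  have : MeasurableSingletonClass F := ⟨fun _ => MeasurableSpace.measurableSet_top⟩
  refine solvableWithin_of_scheme hp (coverScheme hp F hF hne) rfl rfl rfl
    (L := 4 * d * Real.log (4 * d / (ε / (8 * n * K')))) ?_ ?_ _ ?_ ?_
  · refine mul_nonneg (by positivity) (Real.log_nonneg ?_)
    rw [le_div_iff₀ hθ]
    linarith
  · intro S
    simpa [coverScheme] using hcard
  · intro D hD
    obtain ⟨h, hh, hrisk⟩ := exists_risk_le hp D (η := ε / 8) (by positivity)
    obtain ⟨h', hh', hclose⟩ := hcov h hh
    -- The comparator may depend on `D`: it occurs only in the analysis, never in the algorithm.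
    refine ⟨fun _ => ⟨h', hh'⟩, measurable_const, fun _ => le_rfl, fun T hT => ?_⟩
    have hall : {S : Transcript X n 0 | ∀ k, risk g (D k)
        ((coverScheme hp F hF hne).hyp S ⟨h', hh'⟩) ≤ opt H g D + ε / 4} = Set.univ := by
      refine Set.eq_univ_of_forall fun S k => ?_
      change risk g (D k) h' ≤ _
      have hm : MeasurableSet {x | h x ≠ h' x} :=
        (measurableSet_eq_fun (hp.measurable h hh) (hp.measurable h' (hF hh'))).compl
      have h1 := risk_le_add hp.loss_mem (D k) (hp.measurable h hh) (hp.measurable h' (hF hh'))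
      have h2 : (D k : Measure (X × Bool)).real {z | h z.1 ≠ h' z.1} ≤ ε / 8 := by
        have h3 := hD k _ hm
        rw [Measure.map_apply measurable_fst hm] at h3
        have h4 := ENNReal.toReal_mono (ENNReal.mul_ne_top ENNReal.ofReal_ne_top
          (measure_ne_top _ _)) (h3.trans (mul_le_mul_left (ENNReal.ofReal_le_ofReal hKK) _))
        rw [ENNReal.toReal_mul, ENNReal.toReal_ofReal (by linarith), ← measureReal_def] at h4
        calc (D k : Measure (X × Bool)).real {z | h z.1 ≠ h' z.1}
            ≤ K' * (P k : Measure X).real {x | h x ≠ h' x} := h4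
          _ ≤ K' * (n * (ε / (8 * n * K'))) := by
              gcongr
              exact (real_le_mul_uniformMixture hp.n_pos (fun i => (P i : Measure X)) k _).trans
                (by gcongr)
          _ = ε / 8 := by field_simp
      linarith [hrisk k]
    rw [hall, Set.compl_univ, measure_empty]
    exact zero_le
  · simpa using hN

theorem exists_solvableWithin_dominatedBy (p : MvPolynomial (Fin 3) ℝ) : ∃ C : ℝ, 0 < C ∧
    ∀ (X : Type*) [MeasurableSpace X] (H : Set (X → Bool)) (d n : ℕ) (g : Bool → Bool → ℝ)
      (ε δ : ℝ), IsProblem H d n g ε δ → ∀ P : Fin n → ProbabilityMeasure X,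
        SolvableWithin H g ε δ (C * rate d n ε δ)
          (dominatedBy (MvPolynomial.eval ![1 / ε, (d : ℝ), (n : ℝ)] p) P) := by
  obtain ⟨A, k, hA, hpoly⟩ := exists_eval_le_mul_pow p
  have ha : 0 ≤ Real.log (32 * A) := Real.log_nonneg (by linarith)
  -- Each 44 is `4 * 11`, the 11 coming from `add_div_le_rate`; the final 1 pays for rounding up the
  -- number of rounds.
  refine ⟨160 * (3 + 44 + 44 * Real.log (32 * A) + 4 * (k + 1)) + 1, by positivity, ?_⟩
  intro X _ H d n g ε δ hp P
  have hrate := one_le_rate (d := d) (n := n) (ε := ε) (δ := δ)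
  rcases Nat.eq_zero_or_pos d with rfl | hd
  · exact solvableWithin_of_dim_zero hp (by positivity) _
  have hn1 : (1 : ℝ) ≤ n := by exact_mod_cast hp.n_pos
  have hd1 : (1 : ℝ) ≤ d := by exact_mod_cast hd
  have hε := hp.eps_mem
  have hε0 := hε.1
  have hdn : (1 : ℝ) ≤ d * n := by nlinarith
  set y : ℝ := d * n / ε with hy
  have hy1 : 1 ≤ y := by
    rw [hy, le_div_iff₀ hε0]
    linarith [hε.2]
  have hdy : (d : ℝ) * n ≤ y := by
    rw [hy, le_div_iff₀ hε0]
    exact mul_le_of_le_one_right (by positivity) hε.2.le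
  refine solvableWithin_dominatedBy hp hd (K' := A * y ^ k) (hpoly _ y hy1 ?_ ?_)
    (one_le_mul_of_one_le_of_one_le hA (one_le_pow₀ hy1)) P ?_
  · intro i
    fin_cases i <;> simp [hε0.le]
  · intro i
    fin_cases i
    · simp only [hy]
      exact div_le_div_of_nonneg_right hdn hε0.le
    · exact le_trans (le_mul_of_one_le_right (by positivity) hn1) hdy
    · exact le_trans (le_mul_of_one_le_left (by positivity) hd1) hdy
  · have e1 : 4 * d / (ε / (8 * n * (A * y ^ k))) = 32 * A * y ^ (k + 1) := by
      rw [pow_succ]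
      nth_rewrite 3 [hy]
      field_simp
      ring
    have e2 : Real.log (32 * A * y ^ (k + 1)) = Real.log (32 * A) + (k + 1) * Real.log y := by
      rw [Real.log_mul (by positivity) (by positivity), Real.log_pow]
      push_cast
      ring
    rw [e1, e2]
    have b1 := conf_div_le_rate (δ := δ) hd hp.n_pos hε
    have b2 := dim_div_le_rate (d := d) (ε := ε) hp.n_pos hp.delta_mem
    have b3 := add_div_le_rate hd hp.n_pos hε hp.delta_mem
    rw [← hy] at b2
    set R := rate d n ε δ
    have b4 : (n : ℝ) / ε ^ 2 ≤ 11 * R := le_trans (by gcongr; linarith) b3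
    have b5 : (d : ℝ) / ε ^ 2 ≤ 11 * R := le_trans (by gcongr; linarith) b3
    have e3 : (3 * n * Real.log (n / δ) + 4 * n +
        4 * d * (Real.log (32 * A) + (k + 1) * Real.log y)) / ε ^ 2 =
        3 * (n * Real.log (n / δ) / ε ^ 2) + 4 * (n / ε ^ 2) +
          4 * Real.log (32 * A) * (d / ε ^ 2) + 4 * (k + 1) * (d * Real.log y / ε ^ 2) := by
      ring
    rw [e3]
    have c1 : 4 * Real.log (32 * A) * (d / ε ^ 2) ≤ 4 * Real.log (32 * A) * (11 * R) := by gcongr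
    have c2 : 4 * (k + 1 : ℝ) * (d * Real.log y / ε ^ 2) ≤ 4 * (k + 1) * R := by gcongr
    linarith

end Dominated

theorem withMarginals_subset_dominatedBy {X : Type*} [MeasurableSpace X] {n : ℕ}
    (μ : Fin n → ProbabilityMeasure X) : withMarginals μ ⊆ dominatedBy 1 μ := by
  intro D hD i A _
  rw [hD i, ENNReal.ofReal_one, one_mul]

theorem SolvableWithin.mono {X : Type*} [MeasurableSpace X] {H : Set (X → Bool)} {n : ℕ}
    {g : Bool → Bool → ℝ} {ε δ N : ℝ} {𝔇 𝔇' : Set (Fin n → ProbabilityMeasure (X × Bool))}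
    (h : SolvableWithin H g ε δ N 𝔇) (hsub : 𝔇' ⊆ 𝔇) : SolvableWithin H g ε δ N 𝔇' := by
  obtain ⟨m, hm, A, hA⟩ := h
  exact ⟨m, hm, A, fun D hD => hA D (hsub hD)⟩

/-! ### Pointwise measurable classes -/

section Pooled

variable {X : Type*} [MeasurableSpace X] {n : ℕ}

/-- The law of a call to a uniformly random oracle. -/
noncomputable def pooled (D : Fin n → ProbabilityMeasure (X × Bool)) :
    Measure (Fin n × (X × Bool)) :=
  uniformMixture fun i => (D i : Measure (X × Bool)).map (Prod.mk i)

theorem isProbabilityMeasure_pooled (hn : 0 < n) (D : Fin n → ProbabilityMeasure (X × Bool)) :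
    IsProbabilityMeasure (pooled D) :=
  have (i : Fin n) : IsProbabilityMeasure ((D i : Measure (X × Bool)).map (Prod.mk i)) :=
    Measure.isProbabilityMeasure_map measurable_prodMk_left.aemeasurable
  isProbabilityMeasure_uniformMixture hn _

theorem lintegral_pooled (D : Fin n → ProbabilityMeasure (X × Bool))
    {F : Fin n × (X × Bool) → ℝ≥0∞} (hF : Measurable F) :
    ∫⁻ a, F a ∂pooled D = ∑ i, ENNReal.ofReal (1 / n) * ∫⁻ z, F (i, z)
      ∂(D i : Measure (X × Bool)) := by
  rw [pooled, uniformMixture, lintegral_finsetSum_measure]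
  refine Finset.sum_congr rfl fun i _ => ?_
  rw [lintegral_smul_measure, lintegral_map hF measurable_prodMk_left, smul_eq_mul]

theorem lintegral_pi_succ {Y : Type*} [MeasurableSpace Y] (ν : Measure Y) [IsProbabilityMeasure ν]
    (s : ℕ) {F : (Fin (s + 1) → Y) → ℝ≥0∞} (hF : Measurable F) :
    ∫⁻ y, F y ∂(Measure.pi fun _ => ν) =
      ∫⁻ y, ∫⁻ a, F (Fin.snoc y a) ∂ν ∂(Measure.pi fun _ : Fin s => ν) := by
  have e := (measurePreserving_piFinSuccAbove (fun _ : Fin (s + 1) => ν) (Fin.last s)).symm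
  have he : ∀ q : Y × (Fin s → Y),
      (MeasurableEquiv.piFinSuccAbove (fun _ => Y) (Fin.last s)).symm q =
        (Fin.snoc q.2 q.1 : Fin (s + 1) → Y) := fun q => by
    simp [MeasurableEquiv.piFinSuccAbove_symm_apply, Fin.insertNthEquiv, Fin.insertNth_last']
  rw [← e.lintegral_comp hF, lintegral_prod_symm _ (by exact (hF.comp e.measurable).aemeasurable)]
  simp_rw [he]

/-- Preliminary queries are uniform whatever the transcript, so the preliminary calls are
independent pooled draws. -/
theorem Scheme.law_eq_pi {H : Set (X → Bool)} {m₁ : ℕ} {J : Type*} [Fintype J]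
    (E : Scheme H n m₁ J) (T : ℕ) (hT : 0 < T) (D : Fin n → ProbabilityMeasure (X × Bool)) {s : ℕ}
    (hs : s ≤ m₁) : (E.algorithm T hT).law D s = Measure.pi fun _ => pooled D := by
  have := isProbabilityMeasure_pooled E.n_pos D
  induction s with
  | zero =>
    rw [Algorithm.law, Measure.pi_of_empty _ Fin.elim0]
  | succ s ih =>
    refine Measure.ext_of_lintegral _ fun F hF => ?_
    rw [E.lintegral_law_succ T hT D s hF, ih (by omega), lintegral_pi_succ _ s hF]
    refine lintegral_congr fun τ => ?_
    refine Eq.trans ?_ (lintegral_pooled D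
      (hF.comp ((measurable_snoc s).comp (measurable_prodMk_left (x := τ))))).symm
    simp only [E.query_of_lt (by omega : s < m₁)]
    rfl

end Pooled

/-- The tangent bound at `8 * d / θ` leaves `m * θ / 4`, half of the right-hand side. The conclusion
serves twice: for the failure probability of the sample and for the logarithm of the total prior
mass. -/
theorem log_conf_add_log_growth_le {d m : ℕ} {θ δ : ℝ} (hd : 1 ≤ d) (hθ : 0 < θ) (hθ1 : θ ≤ 1)
    (hm : 4 / θ * (Real.log (2 / δ) + 1 + d * Real.log (8 * d / θ)) ≤ m) :
    Real.log (2 / δ) + d * Real.log (2 * m + 1) ≤ m * θ / 2 := by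
  have hd1 : (1 : ℝ) ≤ d := by exact_mod_cast hd
  have h1 : Real.log (2 * m + 1) ≤ (2 * m + 1) / (8 * d / θ) + Real.log (8 * d / θ) :=
    log_le_div_add_log (by positivity) (by positivity)
  have h2 : d * ((2 * m + 1) / (8 * d / θ)) = m * θ / 4 + θ / 8 := by
    field_simp
    ring
  have h3 : Real.log (2 / δ) + 1 + d * Real.log (8 * d / θ) ≤ m * θ / 4 := by
    rw [div_mul_eq_mul_div, div_le_iff₀ hθ] at hm
    linarith
  have h4 : d * Real.log (2 * m + 1) ≤
      d * ((2 * m + 1) / (8 * d / θ) + Real.log (8 * d / θ)) :=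
    mul_le_mul_of_nonneg_left h1 (by linarith)
  rw [mul_add, h2] at h4
  linarith

/-! ### Empirical covers from a pooled sample -/

section Enumerated

variable {X : Type*} [MeasurableSpace X] {H : Set (X → Bool)} {d n : ℕ} {g : Bool → Bool → ℝ}
  {ε δ : ℝ}

/-- The second alternative makes the search total: a labelling that is never realised gets the
default index 0. -/
theorem exists_first {X : Type*} {n : ℕ} (u : ℕ → X → Bool) {m : ℕ} (b : Fin m → Bool) (S : Transcript X n m) :
    ∃ k, (∀ j, u k (S j).2.1 = b j) ∨ ∀ l, ¬ ∀ j, u l (S j).2.1 = b j := by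
  by_cases h : ∃ k, ∀ j, u k (S j).2.1 = b j
  · exact h.imp fun _ hk => Or.inl hk
  · exact ⟨0, Or.inr (not_exists.1 h)⟩

open Classical in
/-- The first classifier of the sequence `u` that labels the sample `S` by `b`. -/
noncomputable def firstIndex {X : Type*} {n : ℕ} (u : ℕ → X → Bool) {m : ℕ} (b : Fin m → Bool)
    (S : Transcript X n m) : ℕ := Nat.find (exists_first u b S)

theorem firstIndex_spec {X : Type*} {n : ℕ} (u : ℕ → X → Bool) {m : ℕ} {b : Fin m → Bool} {S : Transcript X n m}
    (h : ∃ k, ∀ j, u k (S j).2.1 = b j) (j : Fin m) : u (firstIndex u b S) (S j).2.1 = b j := by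
  classical
  rcases Nat.find_spec (exists_first u b S) with h1 | h1
  · exact h1 j
  · exact absurd h (not_exists.2 h1)

theorem measurableSet_pattern {u : ℕ → X → Bool} (hu : ∀ k, Measurable (u k)) {m : ℕ}
    (b : Fin m → Bool) (k : ℕ) :
    MeasurableSet {S : Transcript X n m | ∀ j, u k (S j).2.1 = b j} := by
  rw [Set.ofPred_forall]
  exact MeasurableSet.iInter fun j => measurableSet_eq_fun
    ((hu k).comp (measurable_fst.comp (measurable_snd.comp (measurable_pi_apply j))))
    measurable_const

/-- Choosing the first index of a countable enumeration, rather than an arbitrary realiser, makes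
the hypotheses measurable in the sample. -/
theorem measurable_firstIndex {u : ℕ → X → Bool} (hu : ∀ k, Measurable (u k)) {m : ℕ}
    (b : Fin m → Bool) : Measurable (firstIndex u b : Transcript X n m → ℕ) := by
  classical
  refine measurable_find _ fun k => ?_
  have h : {S : Transcript X n m | ∀ l, ¬ ∀ j, u l (S j).2.1 = b j} =
      ⋂ l, {S : Transcript X n m | ∀ j, u l (S j).2.1 = b j}ᶜ := by
    ext S
    simp
  have hm : MeasurableSet {S : Transcript X n m | ∀ l, ¬ ∀ j, u l (S j).2.1 = b j} := by
    rw [h]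
    exact MeasurableSet.iInter fun l => (measurableSet_pattern hu b l).compl
  exact (measurableSet_pattern hu b k).union hm

open Classical in
/-- The scheme that plays on the first classifiers of a sequence to realise each labelling of the
preliminary sample. -/
noncomputable def patternScheme (hp : IsProblem H d n g ε δ) (u : ℕ → X → Bool)
    (hu : ∀ k, u k ∈ H) (m : ℕ) : Scheme H n m (Fin m → Bool) where
  hyp S b := u (firstIndex u b S)
  -- There are `2 ^ m` indices, but the prior vanishes on unrealised labellings, so its mass is
  -- bounded by the growth function.
  prior S b := if ∃ k, ∀ j, u k (S j).2.1 = b j then 1 else 0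
  mem _ _ := hu _
  measurable_hyp b := by
    have h : Measurable fun q : ℕ × X => u q.1 q.2 :=
      measurable_from_prod_countable_right fun k => hp.measurable _ (hu k)
    exact h.comp (((measurable_firstIndex (fun k => hp.measurable _ (hu k)) b).comp
      measurable_fst).prodMk measurable_snd)
  measurable_prior := by
    refine measurable_pi_lambda _ fun b => Measurable.ite ?_ measurable_const measurable_const
    rw [Set.ofPred_exists]
    exact MeasurableSet.iUnion fun k =>
      measurableSet_pattern (fun k => hp.measurable _ (hu k)) b k
  prior_nonneg S b := by split_ifs <;> simp
  prior_pos S := by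
    refine Finset.sum_pos' (fun b _ => by split_ifs <;> simp)
      ⟨fun j => u 0 (S j).2.1, Finset.mem_univ _, ?_⟩
    rw [if_pos ⟨0, fun _ => rfl⟩]
    exact zero_lt_one
  g := g
  g_mem := hp.loss_mem
  n_pos := hp.n_pos
  β := ε / (40 * n)
  γ := ε / 40

theorem sum_prior_patternScheme_le (hp : IsProblem H d n g ε δ) (u : ℕ → X → Bool)
    (hu : ∀ k, u k ∈ H) (m : ℕ) (S : Transcript X n m) :
    ∑ b, (patternScheme hp u hu m).prior S b ≤ ((m : ℝ) + 1) ^ d := by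
  classical
  have h1 : (patterns H fun j => (S j).2.1).ncard ≤ (m + 1) ^ d := by
    simpa using ncard_patterns_le hp.vcDim_eq fun j => (S j).2.1
  have h2 : ∑ b, (patternScheme hp u hu m).prior S b =
      ((Finset.univ.filter fun b : Fin m → Bool => ∃ k, ∀ j, u k (S j).2.1 = b j).card : ℝ) := by
    simp only [patternScheme, Finset.sum_boole]
  have h3 : (Finset.univ.filter fun b : Fin m → Bool => ∃ k, ∀ j, u k (S j).2.1 = b j).card ≤
      (patterns H fun j => (S j).2.1).ncard := by
    rw [← Set.ncard_coe_finset]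
    refine Set.ncard_le_ncard (fun b hb => ?_) (Set.toFinite _)
    obtain ⟨k, hk⟩ := by simpa using hb
    exact ⟨u k, hu k, hk⟩
  rw [h2]
  exact_mod_cast h3.trans h1

/-- With high probability, every classifier of the sequence that agrees with `h` on a pooled
sample is close to `h`. -/
theorem measure_disagree_le (hp : IsProblem H d n g ε δ) (hd : 1 ≤ d) (u : ℕ → X → Bool)
    (hu : ∀ k, u k ∈ H) {h : X → Bool} (hh : h ∈ H) (D : Fin n → ProbabilityMeasure (X × Bool))
    {θ : ℝ} (hθ : 0 < θ) (hθ1 : θ ≤ 1) {m : ℕ}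
    (hm : 4 / θ * (Real.log (2 / δ) + 1 + d * Real.log (8 * d / θ)) ≤ m) :
    Measure.pi (fun _ : Fin m => pooled D) {S | ∃ k, θ ≤ (pooled D).real
      {a | u k a.2.1 ≠ h a.2.1} ∧ ∀ j, u k (S j).2.1 = h (S j).2.1} ≤ ENNReal.ofReal (δ / 2) := by
  classical
  have := isProbabilityMeasure_pooled hp.n_pos D
  have hδ := hp.delta_mem.1
  let I := {k : ℕ // θ ≤ (pooled D).real {a | u k a.2.1 ≠ h a.2.1}}
  let A : I → Set (Fin n × (X × Bool)) := fun k => {a | u k.1 a.2.1 ≠ h a.2.1}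
  have hA : ∀ k, MeasurableSet (A k) := fun k =>
    (measurableSet_eq_fun ((hp.measurable _ (hu k.1)).comp (measurable_fst.comp measurable_snd))
      ((hp.measurable _ hh).comp (measurable_fst.comp measurable_snd))).compl
  have key := measure_missing_mul_le (pooled D) A hA (ENNReal.ofReal θ)
    -- A trace of a disagreement set is the pattern of `u k` xored with the fixed pattern of `h`, so
    -- there are no more traces than patterns of `H` on the `2 * m` points.
    (fun k => ENNReal.ofReal_le_of_le_toReal k.2) m ((2 * m + 1) ^ d) (fun x => by
      have hcard : (patterns H fun p => (x p).2.1).ncard ≤ (2 * m + 1) ^ d := by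
        simpa [mul_comm] using ncard_patterns_le hp.vcDim_eq fun p => (x p).2.1
      refine le_trans ?_ hcard
      refine le_trans (Set.ncard_le_ncard ?_ (Set.toFinite _)) (Set.ncard_image_le
        (f := fun (b : Fin m × Bool → Bool) p => xor (b p) (h (x p).2.1)) (Set.toFinite _))
      rintro _ ⟨k, rfl⟩
      refine ⟨fun p => u k.1 (x p).2.1, ⟨u k.1, hu _, fun _ => rfl⟩, funext fun p => ?_⟩
      by_cases hx : u k.1 (x p).2.1 = h (x p).2.1 <;> simp [A, hx])
  have hset : {S : Fin m → Fin n × (X × Bool) | ∃ k, θ ≤ (pooled D).real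
      {a | u k a.2.1 ≠ h a.2.1} ∧ ∀ j, u k (S j).2.1 = h (S j).2.1} =
      {S | ∃ k, ∀ j, S j ∉ A k} := by
    ext S
    simp [A, I]
  rw [hset]
  set B := Measure.pi (fun _ : Fin m => pooled D) {S | ∃ k, ∀ j, S j ∉ A k}
  -- Since `exp (θ / 2) ≤ 1 + θ`, the power exceeds `exp (m * θ / 2)`, which the choice of `m` makes
  -- large enough.
  have hgrow : ((2 * m + 1 : ℝ)) ^ d ≤ δ / 2 * (1 + θ) ^ m := by
    have h1 : Real.log (2 / δ * (2 * m + 1) ^ d) ≤ m * (θ / 2) := by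
      rw [Real.log_mul (by positivity) (by positivity), Real.log_pow]
      linarith [log_conf_add_log_growth_le hd hθ hθ1 hm]
    have h2 : 2 / δ * (2 * m + 1 : ℝ) ^ d ≤ (1 + θ) ^ m := by
      calc 2 / δ * (2 * m + 1 : ℝ) ^ d ≤ Real.exp (m * (θ / 2)) :=
            (Real.log_le_iff_le_exp (by positivity)).1 h1
        _ = Real.exp (θ / 2) ^ m := Real.exp_nat_mul _ _
        _ ≤ (1 + θ) ^ m := by
            refine pow_le_pow_left₀ (Real.exp_nonneg _) ?_ m
            have := exp_le_one_add_add_sq (x := θ / 2)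
              (by rw [abs_of_pos (by positivity)]; linarith)
            nlinarith
    calc (2 * m + 1 : ℝ) ^ d = δ / 2 * (2 / δ * (2 * m + 1) ^ d) := by field_simp
      _ ≤ δ / 2 * (1 + θ) ^ m := by gcongr
  have h1 : (1 + ENNReal.ofReal θ) ^ m = ENNReal.ofReal ((1 + θ) ^ m) := by
    rw [ENNReal.ofReal_pow (by positivity), ENNReal.ofReal_add zero_le_one hθ.le,
      ENNReal.ofReal_one]
  have h2 : (((2 * m + 1) ^ d : ℕ) : ℝ≥0∞) ≤
      ENNReal.ofReal ((1 + θ) ^ m) * ENNReal.ofReal (δ / 2) := by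
    rw [← ENNReal.ofReal_mul (by positivity), ← ENNReal.ofReal_natCast]
    refine ENNReal.ofReal_le_ofReal ?_
    push_cast
    linarith
  rw [h1] at key
  exact (ENNReal.mul_le_mul_iff_right (ENNReal.ofReal_pos.2 (by positivity)).ne'
    ENNReal.ofReal_ne_top).1 (key.trans h2)

/-- The comparator is indexed by the labels that a near-optimal `h` gives to the sample. The
hypothesis selected for them agrees with `h` there, so it is probably within `ε / (8 * n)` of `h`
under the pooled law and within `ε / 8` under each `D k`. -/
theorem solvableWithin_univ (hp : IsProblem H d n g ε δ) (hd : 1 ≤ d)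
    (hpm : PointwiseMeasurable H) {m : ℕ}
    (hm : 4 / (ε / (8 * n)) * (Real.log (2 / δ) + 1 + d * Real.log (8 * d / (ε / (8 * n)))) ≤ m)
    {N : ℝ} (hN : m + (160 * ((3 * n * Real.log (n / δ) + 4 * n + m * (ε / (8 * n)) / 2) /
      ε ^ 2) + 1) ≤ N) : SolvableWithin (n := n) H g ε δ N Set.univ := by
  classical
  have hn1 : (1 : ℝ) ≤ n := by exact_mod_cast hp.n_pos
  have hε := hp.eps_mem
  have hε0 := hε.1
  have hδ := hp.delta_mem
  have hθ : 0 < ε / (8 * n) := by positivity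
  have hθ1 : ε / (8 * n) ≤ 1 := by
    rw [div_le_one (by positivity)]
    linarith [hε.2]
  obtain ⟨H₀, hsub, hcount, hlim⟩ := hpm
  have hne : H₀.Nonempty := by
    obtain ⟨h, hh⟩ := hp.nonempty
    obtain ⟨v, hv, -⟩ := hlim h hh
    exact ⟨v 0, hv 0⟩
  obtain ⟨u, hurange⟩ := hcount.exists_eq_range hne
  have hu : ∀ k, u k ∈ H := fun k => hsub (hurange ▸ Set.mem_range_self k)
  refine solvableWithin_of_scheme hp (patternScheme hp u hu m) rfl rfl rfl
    (L := m * (ε / (8 * n)) / 2) (by positivity) ?_ _ ?_ hN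
  · intro S
    have hlog2 : 0 ≤ Real.log (2 / δ) := Real.log_nonneg (by
      rw [le_div_iff₀ hδ.1]
      linarith [hδ.2])
    have h1 := log_conf_add_log_growth_le hd hθ hθ1 hm
    calc Real.log (∑ b, (patternScheme hp u hu m).prior S b)
        ≤ Real.log (((m : ℝ) + 1) ^ d) := Real.log_le_log ((patternScheme hp u hu m).prior_pos S)
          (sum_prior_patternScheme_le hp u hu m S)
      _ = d * Real.log (m + 1) := Real.log_pow _ _
      _ ≤ d * Real.log (2 * m + 1) := by
          gcongr
          linarith [Nat.cast_nonneg (α := ℝ) m]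
      _ ≤ m * (ε / (8 * n)) / 2 := by linarith
  · intro D _
    obtain ⟨h, hh, hrisk⟩ := exists_risk_le hp D (η := ε / 8) (by positivity)
    -- `h` itself need not be enumerated, but an approximating sequence eventually agrees with it on
    -- finitely many points.
    have hreal : ∀ S : Transcript X n m, ∃ k, ∀ j, u k (S j).2.1 = h (S j).2.1 := by
      intro S
      obtain ⟨v, hv, hconv⟩ := hlim h hh
      obtain ⟨l, hl⟩ := (Filter.eventually_all.2 fun j => hconv (S j).2.1).exists
      obtain ⟨k, hk⟩ : v l ∈ Set.range u := hurange ▸ hv l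
      exact ⟨k, fun j => by rw [hk, hl j]⟩
    refine ⟨fun S j => h (S j).2.1, ?_, fun S => ?_, fun T hT => ?_⟩
    · exact measurable_pi_lambda _ fun j => (hp.measurable h hh).comp
        (measurable_fst.comp (measurable_snd.comp (measurable_pi_apply j)))
    · simp only [patternScheme, if_pos (hreal S), le_refl]
    · rw [(patternScheme hp u hu m).law_eq_pi T hT D le_rfl]
      refine le_trans (measure_mono ?_) (measure_disagree_le hp hd u hu hh D hθ hθ1 hm)
      intro S hS
      by_contra hnot
      refine hS fun k => ?_
      change risk g (D k) (u (firstIndex u (fun j => h (S j).2.1) S)) ≤ _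
      set κ := firstIndex u (fun j => h (S j).2.1) S with hκ
      have hclose : (pooled D).real {a | u κ a.2.1 ≠ h a.2.1} < ε / (8 * n) := by
        by_contra hge
        exact hnot ⟨κ, not_lt.1 hge, firstIndex_spec u (hreal S)⟩
      have hprob (i : Fin n) :
          IsProbabilityMeasure ((D i : Measure (X × Bool)).map (Prod.mk i)) :=
        Measure.isProbabilityMeasure_map measurable_prodMk_left.aemeasurable
      have hmeas : MeasurableSet {a : Fin n × (X × Bool) | u κ a.2.1 ≠ h a.2.1} :=
        (measurableSet_eq_fun ((hp.measurable _ (hu κ)).comp (measurable_fst.comp measurable_snd))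
          ((hp.measurable _ hh).comp (measurable_fst.comp measurable_snd))).compl
      have h1 := real_le_mul_uniformMixture hp.n_pos
        (fun i => (D i : Measure (X × Bool)).map (Prod.mk i)) k
        {a | u κ a.2.1 ≠ h a.2.1}
      rw [map_measureReal_apply measurable_prodMk_left hmeas] at h1
      have h2 : (D k : Measure (X × Bool)).real {z | h z.1 ≠ u κ z.1} ≤ ε / 8 := by
        calc (D k : Measure (X × Bool)).real {z | h z.1 ≠ u κ z.1}
            = (D k : Measure (X × Bool)).real
                (Prod.mk k ⁻¹' {a : Fin n × (X × Bool) | u κ a.2.1 ≠ h a.2.1}) := by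
              congr 1
              ext z
              simp [ne_comm]
          _ ≤ n * (pooled D).real {a | u κ a.2.1 ≠ h a.2.1} := h1
          _ ≤ n * (ε / (8 * n)) := by gcongr
          _ = ε / 8 := by field_simp
      have h3 := risk_le_add hp.loss_mem (D k) (hp.measurable h hh) (hp.measurable _ (hu κ))
      linarith [hrisk k]

end Enumerated

theorem exists_solvableWithin_univ (c : ℝ) (hc : 0 < c) : ∃ C : ℝ, 0 < C ∧
    ∀ (X : Type*) [MeasurableSpace X] (H : Set (X → Bool)) (d n : ℕ) (g : Bool → Bool → ℝ)
      (ε δ : ℝ), IsProblem H d n g ε δ → PointwiseMeasurable H → ε ≤ c / n →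
        SolvableWithin (n := n) H g ε δ (C * rate d n ε δ) Set.univ := by
  -- The first two terms pay for the preliminary calls and the rest for the rounds. Here `68 = 1 + 6
  -- * 11 + 1` bounds `Q / ε ^ 2`, `136 = 2 * 68`, and `44 + 11 = 5 * 11`.
  refine ⟨32 * c * 68 + 1 + (160 * (3 + 44 + 136 + 11) + 1), by positivity, ?_⟩
  intro X _ H d n g ε δ hp hpm hεc
  have hrate := one_le_rate (d := d) (n := n) (ε := ε) (δ := δ)
  rcases Nat.eq_zero_or_pos d with rfl | hd
  · exact solvableWithin_of_dim_zero hp (by positivity) _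
  have hn1 : (1 : ℝ) ≤ n := by exact_mod_cast hp.n_pos
  have hd1 : (1 : ℝ) ≤ d := by exact_mod_cast hd
  have hε := hp.eps_mem
  have hε0 := hε.1
  have hδ := hp.delta_mem
  have hδ0 := hδ.1
  have b1 := conf_div_le_rate (δ := δ) hd hp.n_pos hε
  have b2 := dim_div_le_rate (d := d) (ε := ε) hp.n_pos hδ
  have b3 := add_div_le_rate hd hp.n_pos hε hδ
  have hy0 := log_dim_nonneg hd hp.n_pos hε
  have hℓ0 := log_conf_nonneg hp.n_pos hδ
  set R := rate d n ε δ
  set y : ℝ := d * n / ε with hy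
  have hypos : 0 < y := by positivity
  set Q := Real.log (2 / δ) + 1 + d * Real.log (8 * d / (ε / (8 * n))) with hQ
  have hl2 : Real.log 2 ≤ 1 := by linarith [Real.log_two_lt_d9]
  have e1 : Real.log (8 * d / (ε / (8 * n))) = 6 * Real.log 2 + Real.log y := by
    have : 8 * d / (ε / (8 * n)) = 2 ^ 6 * y := by
      rw [hy]
      field_simp
      norm_num
    rw [this, Real.log_mul (by positivity) hypos.ne', Real.log_pow]
    norm_num
  have e2 : Real.log (2 / δ) ≤ 1 + Real.log (n / δ) := by
    calc Real.log (2 / δ) ≤ Real.log (2 * (n / δ)) := by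
          refine Real.log_le_log (by positivity) ?_
          rw [← mul_div_assoc]
          gcongr
          linarith
      _ = Real.log 2 + Real.log (n / δ) := Real.log_mul (by norm_num) (by positivity)
      _ ≤ _ := by linarith
  have hQ1 : Q ≤ n * Real.log (n / δ) + 6 * (n + d) + d * Real.log y := by
    rw [hQ, e1]
    nlinarith
  have hQ0 : 0 ≤ Q := by
    rw [hQ, e1]
    have h1 : 0 ≤ Real.log (2 / δ) := Real.log_nonneg (by
      rw [le_div_iff₀ hδ0]
      linarith [hδ.2])
    have h2 := Real.log_nonneg one_le_two
    positivity
  have hQR : Q / ε ^ 2 ≤ 68 * R := by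
    calc Q / ε ^ 2 ≤ (n * Real.log (n / δ) + 6 * (n + d) + d * Real.log y) / ε ^ 2 := by gcongr
      _ = n * Real.log (n / δ) / ε ^ 2 + 6 * ((n + d) / ε ^ 2) + d * Real.log y / ε ^ 2 := by ring
      _ ≤ 68 * R := by linarith
  set m := ⌈4 / (ε / (8 * n)) * Q⌉₊ with hm
  have hm1 : 4 / (ε / (8 * n)) * Q ≤ m := Nat.le_ceil _
  have hm2 : (m : ℝ) ≤ 4 / (ε / (8 * n)) * Q + 1 := (Nat.ceil_lt_add_one (by positivity)).le
  refine solvableWithin_univ hp hd hpm hm1 ?_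
  have hnc : n * ε ≤ c := by
    rw [le_div_iff₀ (by positivity)] at hεc
    linarith
  have hmR : (m : ℝ) ≤ 32 * c * 68 * R + R := by
    -- This is where `ε ≤ c / n` enters: `n / ε` is traded for `c / ε ^ 2`.
    have h1 : 4 / (ε / (8 * n)) * Q = 32 * (n * ε) * (Q / ε ^ 2) := by
      field_simp
      ring
    rw [h1] at hm2
    calc (m : ℝ) ≤ 32 * (n * ε) * (Q / ε ^ 2) + 1 := hm2
      _ ≤ 32 * c * (68 * R) + R := by gcongr
      _ = _ := by ring
  have hmL : m * (ε / (8 * n)) / 2 ≤ 2 * Q + n := by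
    have hθ1 : ε / (8 * n) ≤ 1 := by
      rw [div_le_one (by positivity)]
      linarith [hε.2]
    calc m * (ε / (8 * n)) / 2 ≤ (4 / (ε / (8 * n)) * Q + 1) * (ε / (8 * n)) / 2 := by gcongr
      _ = 2 * Q + ε / (8 * n) / 2 := by
          field_simp
          ring
      _ ≤ 2 * Q + n := by linarith
  have hfin : (3 * n * Real.log (n / δ) + 4 * n + m * (ε / (8 * n)) / 2) / ε ^ 2 ≤
      (3 + 44 + 136 + 11) * R := by
    have b4 : (n : ℝ) / ε ^ 2 ≤ 11 * R := le_trans (by gcongr; linarith) b3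
    calc (3 * n * Real.log (n / δ) + 4 * n + m * (ε / (8 * n)) / 2) / ε ^ 2
        ≤ (3 * n * Real.log (n / δ) + 4 * n + (2 * Q + n)) / ε ^ 2 := by gcongr
      _ = 3 * (n * Real.log (n / δ) / ε ^ 2) + 5 * (n / ε ^ 2) + 2 * (Q / ε ^ 2) := by ring
      _ ≤ _ := by linarith
  linarith

end CollabLearning

theorem mainTheorem7 :
    (∀ c : ℝ, 0 < c → ∃ C : ℝ, 0 < C ∧
      ∀ (X : Type*) [MeasurableSpace X] (H : Set (X → Bool)) (d n : ℕ) (g : Bool → Bool → ℝ)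
        (ε δ : ℝ), CollabLearning.IsProblem H d n g ε δ →
        CollabLearning.PointwiseMeasurable H → ε ≤ c / n →
        CollabLearning.SolvableWithin (n := n) H g ε δ (C * CollabLearning.rate d n ε δ)
          Set.univ) ∧
    (∃ C : ℝ, 0 < C ∧
      ∀ (X : Type*) [MeasurableSpace X] (H : Set (X → Bool)) (d n : ℕ) (g : Bool → Bool → ℝ)
        (ε δ : ℝ), CollabLearning.IsProblem H d n g ε δ →
        ∀ μ : Fin n → MeasureTheory.ProbabilityMeasure X,
          CollabLearning.SolvableWithin H g ε δ (C * CollabLearning.rate d n ε δ)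
            (CollabLearning.withMarginals μ)) ∧
    (∀ p : MvPolynomial (Fin 3) ℝ, ∃ C : ℝ, 0 < C ∧
      ∀ (X : Type*) [MeasurableSpace X] (H : Set (X → Bool)) (d n : ℕ) (g : Bool → Bool → ℝ)
        (ε δ : ℝ), CollabLearning.IsProblem H d n g ε δ →
        ∀ P : Fin n → MeasureTheory.ProbabilityMeasure X,
          CollabLearning.SolvableWithin H g ε δ (C * CollabLearning.rate d n ε δ)
            (CollabLearning.dominatedBy
              (MvPolynomial.eval ![1 / ε, (d : ℝ), (n : ℝ)] p) P)) := by
  refine ⟨fun c hc => CollabLearning.exists_solvableWithin_univ c hc, ?_, fun p =>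
    CollabLearning.exists_solvableWithin_dominatedBy p⟩
  -- A known marginal dominates itself with factor 1, the value of the constant polynomial.
  obtain ⟨C, hC, h⟩ := CollabLearning.exists_solvableWithin_dominatedBy 1
  refine ⟨C, hC, fun X _ H d n g ε δ hp μ => (h X H d n g ε δ hp μ).mono ?_⟩
  rw [map_one]
  exact CollabLearning.withMarginals_subset_dominatedBy μ
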